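/- Let $N$ be a (finite-dimensional, real, smooth) 2-step nilpotent Lie group with Lie algebra $\mathfrak n$, i.e. $[\mathfrak n,[\mathfrak n,\mathfrak n]]=0$ (the abelian case is allowed), and suppose that $N$ admits a cocompact lattice, that is, a discrete subgroup with compact coset space. Let $T^*\mathfrak n=\mathfrak n\ltimes_{\mathrm{coad}}\mathfrak n^*$ be the cotangent Lie algebra, with bracket $$[(x,f),(y,h)]=\bigl([x,y],\ \mathrm{coad}(x)h-\mathrm{coad}(y)f\bigr),\qquad (\mathrm{coad}(x)h)(z)=-h([x,z]),$$ and let $T^*N$ be the simply connected Lie group with Lie algebra $T^*\mathfrak n$. Then: (a) the canonical neutral form $\langle (x,f),(y,h)\rangle=f(y)+h(x)$ on $T^*\mathfrak n$ is the value at the identity of a bi-invariant pseudo-Riemannian metric on $T^*N$ of neutral signature; (b) $T^*N$ admits a cocompact lattice $\Gamma$ such that the compact Hausdorff space $T^*N/\Gamma$ has a smooth manifold structure for which the projection $T^*N\to T^*N/\Gamma$ is a local diffeomorphism, the metric of (a) induces a pseudo-Riemannian metric of neutral signature on $T^*N/\Gamma$ for which the projection is a local isometry, and with this metric $T^*N/\Gamma$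 is naturally reductive with respect to $T^*N$ acting by left translations. Here a pseudo-Riemannian manifold $M$ is naturally reductive with respect to a Lie group $G$ with Lie algebra $\mathfrak g$, acting smoothly and transitively on $M$ by isometries, if for some point $o\in M$ with isotropy group $H$, whose Lie algebra is $\mathfrak h$, there is a subspace $\mathfrak m\subseteq\mathfrak g$ complementary to $\mathfrak h$ with $\mathrm{Ad}(H)\mathfrak m\subseteq\mathfrak m$ and $$\langle [x,y]_{\mathfrak m},z\rangle+\langle y,[x,z]_{\mathfrak m}\rangle=0\qquad\text{for all }x,y,z\in\mathfrak m,$$ where $\mathfrak m$ is identified with $T_oM$ by the differential of the orbit map $a\mapsto a\cdot o$. -/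

import Mathlib

open scoped Manifold ContDiff Bundle

noncomputable section

/-! ### Cocompact lattices -/

/-- A cocompact lattice: a discrete subgroup whose (left) coset space is compact. -/
structure IsCocompactLattice {G : Type*} [Group G] [TopologicalSpace G] (Γ : Subgroup G) :
    Prop where
  discrete : DiscreteTopology Γ
  cocompact : CompactSpace (G ⧸ Γ)

/-! ### The Lie algebra of a smooth real Lie group -/

/-- A smooth real Lie group is regular enough for Mathlib's Lie algebra structure on its tangent
space at the identity. -/
instance leInfty_minSmoothness_real_three : ENat.LEInfty (minSmoothness ℝ 3) :=
  ⟨by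
    rw [minSmoothness_of_isRCLikeNormedField]
    exact ENat.LEInfty.out⟩

/-! ### The cotangent Lie algebra -/

/-- The cotangent Lie algebra of a real Lie algebra `L`: the semidirect product of `L` with its
dual (an abelian ideal), on which `L` acts by the coadjoint representation. -/
def CotangentLieAlgebra (L : Type*) [LieRing L] [LieAlgebra ℝ L] : Type _ :=
  L × Module.Dual ℝ L

namespace CotangentLieAlgebra

variable {L : Type*} [LieRing L] [LieAlgebra ℝ L]

instance : AddCommGroup (CotangentLieAlgebra L) :=
  inferInstanceAs (AddCommGroup (L × Module.Dual ℝ L))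

instance : Module ℝ (CotangentLieAlgebra L) :=
  inferInstanceAs (Module ℝ (L × Module.Dual ℝ L))

/-- The bracket `⁅(x, f), (y, g)⁆ = (⁅x, y⁆, ⁅x, g⁆ - ⁅y, f⁆)`, where `⁅x, g⁆ = - g ⁅x, ·⁆` is
Mathlib's coadjoint action on the dual. -/
instance : Bracket (CotangentLieAlgebra L) (CotangentLieAlgebra L) where
  bracket p q := (⁅p.1, q.1⁆, ⁅p.1, q.2⁆ - ⁅q.1, p.2⁆)

theorem bracket_fst (p q : CotangentLieAlgebra L) : ⁅p, q⁆.1 = ⁅p.1, q.1⁆ := rfl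

theorem bracket_snd (p q : CotangentLieAlgebra L) :
    ⁅p, q⁆.2 = ⁅p.1, q.2⁆ - ⁅q.1, p.2⁆ := rfl

theorem add_fst (p q : CotangentLieAlgebra L) : (p + q).1 = p.1 + q.1 := rfl

theorem add_snd (p q : CotangentLieAlgebra L) : (p + q).2 = p.2 + q.2 := rfl

theorem smul_fst (c : ℝ) (p : CotangentLieAlgebra L) : (c • p).1 = c • p.1 := rfl

theorem smul_snd (c : ℝ) (p : CotangentLieAlgebra L) : (c • p).2 = c • p.2 := rfl

instance : LieRing (CotangentLieAlgebra L) where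
  add_lie p q r := by
    refine Prod.ext ?_ (LinearMap.ext fun y => ?_)
    · simp [bracket_fst, add_fst]
    · simp [bracket_snd, add_snd, add_fst]; ring
  lie_add p q r := by
    refine Prod.ext ?_ (LinearMap.ext fun y => ?_)
    · simp [bracket_fst, add_fst]
    · simp [bracket_snd, add_snd, add_fst]; ring
  lie_self p := by
    refine Prod.ext ?_ (LinearMap.ext fun y => ?_)
    · exact lie_self p.1
    · simp only [bracket_snd, sub_self]; rfl
  leibniz_lie p q r := by
    refine Prod.ext ?_ (LinearMap.ext fun y => ?_)
    · simp [bracket_fst, add_fst]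
    · simp [bracket_snd, add_snd, bracket_fst]; ring

instance : LieAlgebra ℝ (CotangentLieAlgebra L) where
  lie_smul c p q := by
    refine Prod.ext ?_ (LinearMap.ext fun y => ?_)
    · simp [bracket_fst, smul_fst]
    · simp [bracket_snd, smul_snd, smul_fst]; ring

/-- The canonical neutral metric `⟨(x, f), (y, g)⟩ = f y + g x`. -/
def pairing (p q : CotangentLieAlgebra L) : ℝ := p.2 q.1 + q.2 p.1

end CotangentLieAlgebra

/-! ### Pseudo-Riemannian metrics -/

section PseudoRiemannian

variable {E : Type*} [NormedAddCommGroup E] [NormedSpace ℝ E]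
  {H : Type*} [TopologicalSpace H] {I : ModelWithCorners ℝ E H}
  {M : Type*} [TopologicalSpace M] [ChartedSpace H M] [IsManifold I ∞ M]

variable (I M) in
/-- A pseudo-Riemannian metric on a smooth manifold: a smooth section of the bundle of bilinear
forms on the tangent spaces, symmetric and non degenerate at every point. -/
structure PseudoRiemannianMetric where
  /-- The bilinear form on the tangent space at `p`. -/
  val (p : M) : TangentSpace I p →L[ℝ] TangentSpace I p →L[ℝ] ℝ
  symm (p : M) (u v : TangentSpace I p) : val p u v = val p v u
  nondegenerate (p : M) (u : TangentSpace I p) (hu : ∀ v, val p u v = 0) : u = 0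
  contMDiff : ContMDiff I (I.prod 𝓘(ℝ, E →L[ℝ] E →L[ℝ] ℝ)) ∞
    (fun p ↦ Bundle.TotalSpace.mk' (E →L[ℝ] E →L[ℝ] ℝ)
      (E := fun p : M ↦ TangentSpace I p →L[ℝ] TangentSpace I p →L[ℝ] ℝ) p (val p))

/-- A metric is neutral if it has signature `(k, k)` at every point: each tangent space is the
direct sum of a positive definite and a negative definite subspace of the same dimension. -/
def PseudoRiemannianMetric.IsNeutral (g : PseudoRiemannianMetric I M) : Prop :=
  ∀ p : M, ∃ P Q : Submodule ℝ (TangentSpace I p), IsCompl P Q ∧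
    Module.finrank ℝ P = Module.finrank ℝ Q ∧
    (∀ v ∈ P, v ≠ 0 → 0 < g.val p v v) ∧ (∀ v ∈ Q, v ≠ 0 → g.val p v v < 0)

/-- The differentiable map `f : M → M` preserves the metric `g`. -/
def PseudoRiemannianMetric.IsPreservedBy (g : PseudoRiemannianMetric I M) (f : M → M) : Prop :=
  ∀ (p : M) (u v : TangentSpace I p),
    g.val (f p) (mfderiv I I f p u) (mfderiv I I f p v) = g.val p u v

/-- A metric on a group is bi-invariant if all left and right translations are isometries. -/
def PseudoRiemannianMetric.IsBiInvariant [Group M] (g : PseudoRiemannianMetric I M) : Prop :=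
  ∀ a : M, g.IsPreservedBy (fun x => a * x) ∧ g.IsPreservedBy (fun x => x * a)

end PseudoRiemannian

/-! ### Naturally reductive metrics -/

section NaturallyReductive

variable {E : Type*} [NormedAddCommGroup E] [NormedSpace ℝ E] [CompleteSpace E]
  {H : Type*} [TopologicalSpace H] (I : ModelWithCorners ℝ E H)
  {G : Type*} [TopologicalSpace G] [ChartedSpace H G] [Group G] [LieGroup I ∞ G]

/-- The adjoint representation `Ad a` of a Lie group: the differential at the identity of the
conjugation by `a`. -/
def lieAd (a : G) (x : GroupLieAlgebra I G) : GroupLieAlgebra I G :=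
  mfderiv I I (fun b : G => a * b * a⁻¹) 1 x

/-- The Lie algebra of a closed subgroup `K` of a Lie group, as the set of initial velocities of
the smooth one-parameter subgroups which are contained in `K`. -/
def subgroupLieAlgebra (K : Subgroup G) : Set (GroupLieAlgebra I G) :=
  {x | ∃ γ : ℝ → G, ContMDiff 𝓘(ℝ, ℝ) I ∞ γ ∧ (∀ s t, γ (s + t) = γ s * γ t) ∧
    (∀ t, γ t ∈ K) ∧ mfderiv 𝓘(ℝ, ℝ) I γ 0 (1 : ℝ) = x}

variable {E' : Type*} [NormedAddCommGroup E'] [NormedSpace ℝ E']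
  {H' : Type*} [TopologicalSpace H'] {J : ModelWithCorners ℝ E' H'}
  {M : Type*} [TopologicalSpace M] [ChartedSpace H' M] [IsManifold J ∞ M]

/-- The bilinear form induced on the Lie algebra of `G` by the metric at `o`, through the
differential at the identity of the orbit map `a ↦ a • o`. -/
def orbitForm [MulAction G M] (g : PseudoRiemannianMetric J M) (o : M)
    (x y : GroupLieAlgebra I G) : ℝ :=
  g.val ((1 : G) • o) (mfderiv I J (fun a : G => a • o) 1 x)
    (mfderiv I J (fun a : G => a • o) 1 y)

variable (G) in
/-- The pseudo-Riemannian manifold `(M, g)` is naturally reductive with respect to the Lie group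
`G`, acting smoothly and transitively on `M` by isometries: for a point `o` with isotropy group
`K`, whose Lie algebra is `𝔨`, the Lie algebra of `G` has a subspace `𝔪` complementary to `𝔨` with
`Ad(K) 𝔪 ⊆ 𝔪` and `⟨[x, y]_𝔪, z⟩ + ⟨y, [x, z]_𝔪⟩ = 0` for `x y z ∈ 𝔪`, where `𝔪` is identified
with the tangent space at `o` by the differential of the orbit map. The action is not required to
be effective: as usual for a presentation `G / K`, one may divide `G` by the kernel. -/
def PseudoRiemannianMetric.IsNaturallyReductive [MulAction G M]
    (g : PseudoRiemannianMetric J M) : Prop :=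
  ContMDiffSMul I J ∞ G M ∧ MulAction.IsPretransitive G M ∧
  (∀ a : G, g.IsPreservedBy (fun p : M => a • p)) ∧
  ∃ (o : M) (𝔨 𝔪 : Submodule ℝ (GroupLieAlgebra I G)) (hc : IsCompl 𝔪 𝔨),
    (𝔨 : Set (GroupLieAlgebra I G)) = subgroupLieAlgebra I (MulAction.stabilizer G o) ∧
    (∀ a ∈ MulAction.stabilizer G o, ∀ x ∈ 𝔪, lieAd I a x ∈ 𝔪) ∧
    Set.BijOn (mfderiv I J (fun a : G => a • o) 1) 𝔪 Set.univ ∧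
    ∀ x ∈ 𝔪, ∀ y ∈ 𝔪, ∀ z ∈ 𝔪,
      orbitForm I g o (Submodule.projection 𝔪 𝔨 hc ⁅x, y⁆) z + orbitForm I g o y (Submodule.projection 𝔪 𝔨 hc ⁅x, z⁆) = 0

end NaturallyReductive

end

/-! The proof has a metric half and an arithmetic half, joined by the exponential map.

Metric half. The coadjoint terms of the bracket are what makes the pairing ad-invariant
(`pairing_lie`), and the graphs of σ and -σ, for a Euclidean inner product σ : 𝔫 → 𝔫*, show that it
is neutral (`exists_isCompl_pairing`). The cotangent algebra is again two-step nilpotent, so Ad(exp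
X) = 1 + ad X, and on the connected group ad-invariance becomes Ad-invariance
(`isInvariantForm_of_bracket`). Whenever G acts smoothly on M with invertible orbit derivatives, an
Ad-invariant form on the Lie algebra is carried to every tangent space by the orbit maps. The
resulting `orbitMetric` is smooth, G-invariant, and preserved by equivariant maps
(`orbitMetric_map`). This is applied to M = G and to M = G/Γ with Γ discrete: right translations and
the projection are equivariant, which gives bi-invariance and the local isometry. The isotropy
algebra of G/Γ is zero, so 𝔪 is the whole Lie algebra and natural reductivity is just ad-invariance.

Arithmetic half. A lattice of N gives 𝔫 a basis with even integral structure constants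
(`exists_basis_hasEvenConstants`); joined with its dual basis it has the same property in the
cotangent algebra (`hasEvenConstants_basis`); and the integral vectors of such a basis exponentiate
to a lattice (`exists_isCocompactLattice`). Evenness matters because the product is x + y + ½[x, y].

In a two-step group exp is an open homomorphism with discrete kernel from the vector space with this
product, and it is bijective when the group is simply connected. N need be neither connected nor
simply connected: its lattice is only pulled back along exp. The Lie theory used (the differential
of Ad, exp, Baker-Campbell-Hausdorff) is derived from the multiplication read in the chart at the
identity. -/

noncomputable section

open Filter Topology

/-! ### The bracket in terms of a local multiplication -/

section LocalMultiplication

variable {E : Type*} [NormedAddCommGroup E] [NormedSpace ℝ E]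

/-- If `A u` intertwines the two partial derivatives at `u₀` of a local multiplication, then
its derivative is the Lie bracket of the left invariant vector fields. -/
theorem fderiv_eq_lieBracket_of_partial_deriv {m : E × E → E} {u₀ : E}
    (hm : ContDiffAt ℝ ∞ m (u₀, u₀)) {A : E → E} (hA : DifferentiableAt ℝ A u₀) {X Y : E}
    (hA₀ : A u₀ = Y)
    (hl : ∀ v, fderiv ℝ m (u₀, u₀) (v, 0) = v) (hr : ∀ v, fderiv ℝ m (u₀, u₀) (0, v) = v)
    (h : ∀ᶠ u in 𝓝 u₀, fderiv ℝ m (u₀, u) (A u, 0) = fderiv ℝ m (u, u₀) (0, Y)) :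
    fderiv ℝ A u₀ X = VectorField.lieBracket ℝ (fun u => fderiv ℝ m (u, u₀) (0, X))
      (fun u => fderiv ℝ m (u, u₀) (0, Y)) u₀ := by
  have hsymm : IsSymmSndFDerivAt ℝ m (u₀, u₀) :=
    hm.isSymmSndFDerivAt (by
      rw [minSmoothness_of_isRCLikeNormedField]; exact ENat.LEInfty.out)
  have hd : HasFDerivAt (fderiv ℝ m) (fderiv ℝ (fderiv ℝ m) (u₀, u₀)) (u₀, u₀) :=
    ((hm.fderiv_right (m := ∞) (by norm_cast)).differentiableAt (by simp)).hasFDerivAt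
  set D := fderiv ℝ (fderiv ℝ m) (u₀, u₀) with hD
  have h1 : ∀ Z : E, HasFDerivAt (fun u => fderiv ℝ m (u, u₀) (0, Z))
      ((ContinuousLinearMap.apply ℝ E ((0 : E), Z)).comp (D.comp (ContinuousLinearMap.inl ℝ E E)))
      u₀ := by
    intro Z
    have h2 : HasFDerivAt (fun u : E => (u, u₀)) (ContinuousLinearMap.inl ℝ E E) u₀ :=
      hasFDerivAt_prodMk_left u₀ u₀
    exact (ContinuousLinearMap.apply ℝ E ((0 : E), Z)).hasFDerivAt.comp u₀
      (HasFDerivAt.comp (g := fderiv ℝ m) (f := fun u : E => (u, u₀)) u₀ hd h2)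
  have h3 : HasFDerivAt (fun u => fderiv ℝ m (u₀, u) (A u, 0))
      ((fderiv ℝ m (u₀, u₀)).comp ((ContinuousLinearMap.inl ℝ E E).comp (fderiv ℝ A u₀)) +
        (D.comp (ContinuousLinearMap.inr ℝ E E)).flip (A u₀, 0)) u₀ := by
    have h2 : HasFDerivAt (fun u : E => (u₀, u)) (ContinuousLinearMap.inr ℝ E E) u₀ :=
      hasFDerivAt_prodMk_right u₀ u₀
    exact HasFDerivAt.clm_apply (HasFDerivAt.comp (g := fderiv ℝ m) (f := fun u : E => (u₀, u)) u₀ hd h2)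
      ((ContinuousLinearMap.inl ℝ E E).hasFDerivAt.comp u₀ hA.hasFDerivAt)
  have h4 := (h3.congr_of_eventuallyEq (h.mono fun u hu => hu.symm)).unique (h1 Y)
  have h5 := DFunLike.congr_fun h4 X
  simp only [_root_.add_apply, ContinuousLinearMap.comp_apply,
    ContinuousLinearMap.flip_apply, ContinuousLinearMap.inl_apply, ContinuousLinearMap.inr_apply,
    ContinuousLinearMap.apply_apply, hl, hA₀] at h5
  rw [VectorField.lieBracket, (h1 X).fderiv, (h1 Y).fderiv]
  simp only [ContinuousLinearMap.comp_apply, ContinuousLinearMap.inl_apply,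
    ContinuousLinearMap.apply_apply, hr]
  -- `h5` differentiates the intertwining relation along `X`; symmetry of the second derivative
  -- matches its mixed term with the second half of the bracket.
  rw [← h5, hsymm (Y, 0) (0, X)]
  abel

end LocalMultiplication

/-! ### Manifold derivatives in the model spaces -/

section ModelDeriv

variable {E : Type*} [NormedAddCommGroup E] [NormedSpace ℝ E]
  {E' : Type*} [NormedAddCommGroup E'] [NormedSpace ℝ E']
  {E'' : Type*} [NormedAddCommGroup E''] [NormedSpace ℝ E'']
  {M : Type*} [TopologicalSpace M] [ChartedSpace E M]
  {M' : Type*} [TopologicalSpace M'] [ChartedSpace E' M']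
  {M'' : Type*} [TopologicalSpace M''] [ChartedSpace E'' M'']

variable (E E') in
/-- The manifold derivative, as a continuous linear map between the model spaces. -/
def modelDeriv (f : M → M') (x : M) : E →L[ℝ] E' := mfderiv 𝓘(ℝ, E) 𝓘(ℝ, E') f x

/-- `f` has manifold derivative `L` at `x`, where `L` is a map between the model spaces. -/
def HasModelDerivAt (f : M → M') (x : M) (L : E →L[ℝ] E') : Prop :=
  HasMFDerivAt 𝓘(ℝ, E) 𝓘(ℝ, E') f x L

theorem MDifferentiableAt.hasModelDerivAt {f : M → M'} {x : M}
    (h : MDifferentiableAt 𝓘(ℝ, E) 𝓘(ℝ, E') f x) : HasModelDerivAt f x (modelDeriv E E' f x) :=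
  h.hasMFDerivAt

theorem ContMDiff.hasModelDerivAt {f : M → M'} (h : ContMDiff 𝓘(ℝ, E) 𝓘(ℝ, E') ∞ f) (x : M) :
    HasModelDerivAt f x (modelDeriv E E' f x) :=
  (h.mdifferentiableAt (by simp)).hasMFDerivAt

namespace HasModelDerivAt

theorem modelDeriv_eq {f : M → M'} {x : M} {L : E →L[ℝ] E'} (h : HasModelDerivAt f x L) :
    modelDeriv E E' f x = L :=
  HasMFDerivAt.mfderiv h

theorem comp {g : M' → M''} {f : M → M'} {x : M} {y : M'} {L' : E' →L[ℝ] E''}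
    {L : E →L[ℝ] E'} (hg : HasModelDerivAt g y L') (hf : HasModelDerivAt f x L) (h : f x = y) :
    HasModelDerivAt (fun z => g (f z)) x (L'.comp L) := by
  subst h
  exact HasMFDerivAt.comp x hg hf

theorem unique {f : M → M'} {x : M} {L L' : E →L[ℝ] E'} (h : HasModelDerivAt f x L)
    (h' : HasModelDerivAt f x L') : L = L' :=
  h.modelDeriv_eq.symm.trans h'.modelDeriv_eq

theorem hasFDerivAt {f : E → E'} {x : E} {L : E →L[ℝ] E'} (h : HasModelDerivAt f x L) :
    HasFDerivAt f L x :=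
  HasMFDerivAt.hasFDerivAt h

theorem id (x : M) : HasModelDerivAt (fun y : M => y) x (ContinuousLinearMap.id ℝ E) :=
  hasMFDerivAt_id x

end HasModelDerivAt

theorem HasFDerivAt.hasModelDerivAt {f : E → E'} {x : E} {L : E →L[ℝ] E'}
    (h : HasFDerivAt f L x) : HasModelDerivAt f x L :=
  HasFDerivAt.hasMFDerivAt h

end ModelDeriv

/-! ### Translations and the adjoint representation in the model space -/

namespace LieGroup

variable {E : Type*} [NormedAddCommGroup E] [NormedSpace ℝ E]
  {G : Type*} [TopologicalSpace G] [ChartedSpace E G] [Group G] [LieGroup 𝓘(ℝ, E) ∞ G]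

variable (E) in
/-- The differential at `1` of the left translation by `a`, in the model space. -/
def leftDeriv (a : G) : E →L[ℝ] E := modelDeriv E E (fun b : G => a * b) 1

variable (E) in
/-- The differential at `1` of the right translation by `a`, in the model space. -/
def rightDeriv (a : G) : E →L[ℝ] E := modelDeriv E E (fun b : G => b * a) 1

variable (E) in
/-- The adjoint representation, in the model space. -/
def adDeriv (a : G) : E →L[ℝ] E := modelDeriv E E (fun b : G => a * b * a⁻¹) 1

theorem hasModelDerivAt_left (a : G) :
    HasModelDerivAt (fun b : G => a * b) 1 (leftDeriv E a) :=
  (contMDiff_mul_left (I := 𝓘(ℝ, E)) (n := ∞) (a := a)).hasModelDerivAt 1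

theorem hasModelDerivAt_right (a : G) :
    HasModelDerivAt (fun b : G => b * a) 1 (rightDeriv E a) :=
  (contMDiff_mul_right (I := 𝓘(ℝ, E)) (n := ∞) (a := a)).hasModelDerivAt 1

theorem contMDiff_conj (a : G) : ContMDiff 𝓘(ℝ, E) 𝓘(ℝ, E) ∞ (fun b : G => a * b * a⁻¹) :=
  (contMDiff_const.mul contMDiff_id).mul contMDiff_const

theorem hasModelDerivAt_conj (a : G) :
    HasModelDerivAt (fun b : G => a * b * a⁻¹) 1 (adDeriv E a) :=
  (contMDiff_conj a).hasModelDerivAt 1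

/-- Differentiate `a * b = (a * b * a⁻¹) * a` in `b` at `1`. -/
theorem leftDeriv_eq_rightDeriv_comp_adDeriv (a : G) :
    leftDeriv E a = (rightDeriv E a).comp (adDeriv E a) := by
  have h := (hasModelDerivAt_right (E := E) a).comp (hasModelDerivAt_conj a) (by simp)
  simp only [inv_mul_cancel_right] at h
  exact h.modelDeriv_eq

theorem adDeriv_mul (a b : G) :
    adDeriv E (a * b) = (adDeriv E a).comp (adDeriv E b) := by
  have h := (hasModelDerivAt_conj (E := E) a).comp (hasModelDerivAt_conj b) (by simp)
  rw [← h.modelDeriv_eq, adDeriv]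
  congr 1
  ext x
  simp [mul_assoc]

omit [LieGroup 𝓘(ℝ, E) ∞ G] in
@[simp] theorem adDeriv_one : adDeriv E (1 : G) = ContinuousLinearMap.id ℝ E := by
  rw [← (HasModelDerivAt.id (E := E) (1 : G)).modelDeriv_eq, adDeriv]
  simp

variable (E G) in
/-- The preferred chart at the identity. -/
abbrev chartOne : PartialEquiv G E := extChartAt 𝓘(ℝ, E) (1 : G)

omit [LieGroup 𝓘(ℝ, E) ∞ G] in
theorem chartOne_symm_apply_one : (chartOne E G).symm (chartOne E G 1) = 1 := by simp

-- The tangent space at `1` is identified with `E` through this very chart, so the chart and its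
-- inverse have identity derivatives there.
variable (E G) in
theorem hasModelDerivAt_chartOne_symm :
    HasModelDerivAt (chartOne E G).symm (chartOne E G 1) (ContinuousLinearMap.id ℝ E) := by
  have : IsManifold 𝓘(ℝ, E) 1 G := IsManifold.of_le (n := ∞) ENat.LEInfty.out
  have h2 := (mdifferentiableWithinAt_extChartAt_symm (I := 𝓘(ℝ, E))
    (mem_extChartAt_target (I := 𝓘(ℝ, E)) (1 : G))).hasMFDerivWithinAt
  rw [mfderivWithin_range_extChartAt_symm] at h2
  rw [ModelWithCorners.range_eq_univ] at h2
  exact hasMFDerivWithinAt_univ.1 h2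

theorem hasModelDerivAt_chartOne {a : G} (ha : a ∈ (chartOne E G).source) :
    HasModelDerivAt (chartOne E G) a (modelDeriv E E (chartOne E G) a) :=
  have : IsManifold 𝓘(ℝ, E) 1 G := IsManifold.of_le (n := ∞) ENat.LEInfty.out
  (mdifferentiableAt_extChartAt (by simpa using ha)).hasModelDerivAt

variable (E G) in
theorem modelDeriv_chartOne_one :
    modelDeriv E E (chartOne E G) 1 = ContinuousLinearMap.id ℝ E := by
  have : IsManifold 𝓘(ℝ, E) 1 G := IsManifold.of_le (n := ∞) ENat.LEInfty.out
  exact mfderiv_extChartAt_self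

/-- The derivative at the identity of a map, read in the preferred chart. -/
theorem hasFDerivAt_chart_comp {f : G → G} {a : G} (h : f 1 = a) {L : E →L[ℝ] E}
    (hf : HasModelDerivAt f 1 L) (ha : a ∈ (chartOne E G).source) :
    HasFDerivAt (fun v : E => chartOne E G (f ((chartOne E G).symm v)))
      ((modelDeriv E E (chartOne E G) a).comp L) (chartOne E G 1) := by
  have h1 := hf.comp (hasModelDerivAt_chartOne_symm E G) chartOne_symm_apply_one
  have h2 := (hasModelDerivAt_chartOne ha).comp h1 (by simpa using h)
  exact h2.hasFDerivAt

variable (E G) in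
/-- The multiplication read in the preferred chart at the identity. -/
def localMul (p : E × E) : E := chartOne E G ((chartOne E G).symm p.1 * (chartOne E G).symm p.2)

omit [LieGroup 𝓘(ℝ, E) ∞ G] in
variable (E G) in
theorem eventually_symm_mem : ∀ᶠ u in 𝓝 (chartOne E G (1 : G) : E),
    u ∈ (chartOne E G).target ∧ (chartOne E G).symm u ∈ (chartOne E G).source :=
  Filter.mem_of_superset (extChartAt_target_mem_nhds (I := 𝓘(ℝ, E)) (1 : G)) fun _ hu =>
    ⟨hu, (chartOne E G).map_target hu⟩

variable (E G) in
theorem contMDiffAt_chartOne_symm :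
    ContMDiffAt 𝓘(ℝ, E) 𝓘(ℝ, E) ∞ (chartOne E G).symm (chartOne E G 1) :=
  (contMDiffOn_extChartAt_symm (1 : G)).contMDiffAt (extChartAt_target_mem_nhds (1 : G))

/-- A smooth map read in the charts at `1`, with two variables. -/
theorem contDiffAt_chart_comp₂ {f : G × G → G}
    (hf : ContMDiff (𝓘(ℝ, E).prod 𝓘(ℝ, E)) 𝓘(ℝ, E) ∞ f) (h : f (1, 1) = 1) :
    ContDiffAt ℝ ∞ (fun p : E × E =>
      chartOne E G (f ((chartOne E G).symm p.1, (chartOne E G).symm p.2)))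
      (chartOne E G 1, chartOne E G 1) := by
  rw [← contMDiffAt_iff_contDiffAt]
  have h1 : ContMDiffAt 𝓘(ℝ, E × E) 𝓘(ℝ, E) ∞ (fun p : E × E => (chartOne E G).symm p.1)
      (chartOne E G 1, chartOne E G 1) :=
    ContMDiffAt.comp (I' := 𝓘(ℝ, E)) _ (contMDiffAt_chartOne_symm E G)
      contDiff_fst.contMDiff.contMDiffAt
  have h2 : ContMDiffAt 𝓘(ℝ, E × E) 𝓘(ℝ, E) ∞ (fun p : E × E => (chartOne E G).symm p.2)
      (chartOne E G 1, chartOne E G 1) :=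
    ContMDiffAt.comp (I' := 𝓘(ℝ, E)) _ (contMDiffAt_chartOne_symm E G)
      contDiff_snd.contMDiff.contMDiffAt
  have h3 := (hf.contMDiffAt (x := ((chartOne E G).symm (chartOne E G 1),
    (chartOne E G).symm (chartOne E G 1)))).comp
    ((chartOne E G 1, chartOne E G 1) : E × E) (h1.prodMk h2)
  refine ContMDiffAt.comp (I' := 𝓘(ℝ, E)) _ ?_ h3
  have h4 : ContMDiffAt 𝓘(ℝ, E) 𝓘(ℝ, E) ∞ (chartOne E G) (1 : G) := contMDiffAt_extChartAt
  simpa [h] using h4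

variable (E G) in
theorem contDiffAt_localMul :
    ContDiffAt ℝ ∞ (localMul E G) (chartOne E G 1, chartOne E G 1) :=
  contDiffAt_chart_comp₂ (contMDiff_mul 𝓘(ℝ, E) ∞) (by simp)

end LieGroup

/-! ### The Lie bracket and the differential of Ad in the chart at the identity -/

namespace LieGroup

variable {E : Type*} [NormedAddCommGroup E] [NormedSpace ℝ E]
  {G : Type*} [TopologicalSpace G] [ChartedSpace E G] [Group G] [LieGroup 𝓘(ℝ, E) ∞ G]

variable (E G) in
theorem eventually_differentiableAt_localMul_left :
    ∀ᶠ u in 𝓝 (chartOne E G 1), DifferentiableAt ℝ (localMul E G) (u, chartOne E G 1) := by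
  have h : ∀ᶠ p in 𝓝 ((chartOne E G 1, chartOne E G 1) : E × E),
      DifferentiableAt ℝ (localMul E G) p :=
    (((contDiffAt_localMul E G).of_le (m := 1) ENat.LEInfty.out).eventually (by simp)).mono
      fun p hp => hp.differentiableAt (by simp)
  exact (Continuous.prodMk_left (chartOne E G 1)).continuousAt.eventually h

variable (E G) in
theorem eventually_differentiableAt_localMul_right :
    ∀ᶠ u in 𝓝 (chartOne E G 1), DifferentiableAt ℝ (localMul E G) (chartOne E G 1, u) := by
  have h : ∀ᶠ p in 𝓝 ((chartOne E G 1, chartOne E G 1) : E × E),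
      DifferentiableAt ℝ (localMul E G) p :=
    (((contDiffAt_localMul E G).of_le (m := 1) ENat.LEInfty.out).eventually (by simp)).mono
      fun p hp => hp.differentiableAt (by simp)
  exact (Continuous.prodMk_right (chartOne E G 1)).continuousAt.eventually h

theorem fderiv_localMul_inr {u : E} (hu : (chartOne E G).symm u ∈ (chartOne E G).source)
    (hd : DifferentiableAt ℝ (localMul E G) (u, chartOne E G 1)) (X : E) :
    fderiv ℝ (localMul E G) (u, chartOne E G 1) (0, X) =
      modelDeriv E E (chartOne E G) ((chartOne E G).symm u)
        (leftDeriv E ((chartOne E G).symm u) X) := by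
  have h1 := hasFDerivAt_chart_comp (mul_one _) (hasModelDerivAt_left ((chartOne E G).symm u)) hu
  have h2 := HasFDerivAt.comp (g := localMul E G) (f := fun v : E => (u, v)) (chartOne E G 1)
    hd.hasFDerivAt (hasFDerivAt_prodMk_right u (chartOne E G 1))
  exact (DFunLike.congr_fun (h1.unique h2) X).symm

theorem fderiv_localMul_inl {u : E} (hu : (chartOne E G).symm u ∈ (chartOne E G).source)
    (hd : DifferentiableAt ℝ (localMul E G) (chartOne E G 1, u)) (X : E) :
    fderiv ℝ (localMul E G) (chartOne E G 1, u) (X, 0) =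
      modelDeriv E E (chartOne E G) ((chartOne E G).symm u)
        (rightDeriv E ((chartOne E G).symm u) X) := by
  have h1 := hasFDerivAt_chart_comp (a := (chartOne E G).symm u) (one_mul _)
    (hasModelDerivAt_right ((chartOne E G).symm u)) hu
  have h2 := HasFDerivAt.comp (g := localMul E G) (f := fun v : E => (v, u)) (chartOne E G 1)
    hd.hasFDerivAt (hasFDerivAt_prodMk_left (chartOne E G 1) u)
  exact (DFunLike.congr_fun (h1.unique h2) X).symm

omit [LieGroup 𝓘(ℝ, E) ∞ G] in
@[simp] theorem leftDeriv_one : leftDeriv E (1 : G) = ContinuousLinearMap.id ℝ E := by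
  rw [← (HasModelDerivAt.id (E := E) (1 : G)).modelDeriv_eq, leftDeriv]
  simp

omit [LieGroup 𝓘(ℝ, E) ∞ G] in
@[simp] theorem rightDeriv_one : rightDeriv E (1 : G) = ContinuousLinearMap.id ℝ E := by
  rw [← (HasModelDerivAt.id (E := E) (1 : G)).modelDeriv_eq, rightDeriv]
  simp

/-- The bracket of the Lie algebra of `G`, on the model space. -/
def bracket (X Y : E) : E := 
  Bracket.bracket (L := GroupLieAlgebra 𝓘(ℝ, E) G) (M := GroupLieAlgebra 𝓘(ℝ, E) G) X Y

omit [LieGroup 𝓘(ℝ, E) ∞ G] in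
theorem mpullbackWithin_mulInvariantVectorField [IsManifold 𝓘(ℝ, E) 1 G] (X : E) {u : E}
    (hu : u ∈ (chartOne E G).target) :
    VectorField.mpullbackWithin 𝓘(ℝ, E) 𝓘(ℝ, E) (chartOne E G).symm
      (mulInvariantVectorField (I := 𝓘(ℝ, E)) (G := G) X) (Set.range 𝓘(ℝ, E)) u =
      modelDeriv E E (chartOne E G) ((chartOne E G).symm u)
        (leftDeriv E ((chartOne E G).symm u) X) := by
  rw [VectorField.mpullbackWithin_apply]
  rw [ContinuousLinearMap.inverse_eq (mfderivWithin_extChartAt_symm_comp_mfderiv_extChartAt hu)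
    (mfderiv_extChartAt_comp_mfderivWithin_extChartAt_symm hu)]
  rfl

-- Read in the chart, the left invariant field of `Z` is near the base point the partial derivative
-- of `localMul` in its second variable at the identity, so the bracket of the group becomes a
-- bracket of vector fields on `E`.
variable (G) in
theorem bracket_eq_lieBracket (X Y : E) : bracket (G := G) X Y =
    VectorField.lieBracket ℝ
      (fun u => fderiv ℝ (localMul E G) (u, chartOne E G 1) (0, X))
      (fun u => fderiv ℝ (localMul E G) (u, chartOne E G 1) (0, Y)) (chartOne E G 1) := by
  have : IsManifold 𝓘(ℝ, E) 1 G := IsManifold.of_le (n := ∞) ENat.LEInfty.out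
  set V : E → E → E := fun Z => VectorField.mpullbackWithin 𝓘(ℝ, E) 𝓘(ℝ, E) (chartOne E G).symm
    (mulInvariantVectorField (I := 𝓘(ℝ, E)) (G := G) Z) (Set.range 𝓘(ℝ, E)) with hV
  have key : ∀ Z : E, V Z =ᶠ[𝓝 (chartOne E G 1)]
      fun u => fderiv ℝ (localMul E G) (u, chartOne E G 1) (0, Z) := by
    intro Z
    filter_upwards [eventually_symm_mem E G, eventually_differentiableAt_localMul_left E G]
      with u hu hd
    rw [fderiv_localMul_inr hu.2 hd]
    exact mpullbackWithin_mulInvariantVectorField Z hu.1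
  have h0 : bracket (G := G) X Y = VectorField.lieBracketWithin ℝ (V X) (V Y)
      ((chartOne E G).symm ⁻¹' Set.univ ∩ Set.range 𝓘(ℝ, E)) (chartOne E G 1) := by
    refine (GroupLieAlgebra.bracket_def (I := 𝓘(ℝ, E)) (G := G) X Y).trans ?_
    rw [← VectorField.mlieBracketWithin_univ, VectorField.mlieBracketWithin_apply,
      mfderiv_extChartAt_self]
    exact DFunLike.congr_fun (ContinuousLinearMap.inverse_id (R := ℝ) (M := E)) _
  rw [h0, Set.preimage_univ, Set.univ_inter, ModelWithCorners.range_eq_univ,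
    VectorField.lieBracketWithin_univ]
  exact (key X).lieBracket_vectorField_eq (key Y)

/-- The adjoint representation is differentiable at the identity and its differential there is
the bracket. -/
theorem hasFDerivAt_adDeriv_symm (Y : E) : ∃ L : E →L[ℝ] E,
    HasFDerivAt (fun u : E => adDeriv E ((chartOne E G).symm u) Y) L (chartOne E G 1) ∧
      ∀ X, L X = bracket (G := G) X Y := by
  have hA : DifferentiableAt ℝ (fun u : E => adDeriv E ((chartOne E G).symm u) Y)
      (chartOne E G 1) := by
    -- Conjugation, jointly in both variables: Ad is its partial derivative in the second one at the
    -- identity, so Ad inherits regularity from `c`.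
    set c : E × E → E := fun p =>
      chartOne E G ((chartOne E G).symm p.1 * (chartOne E G).symm p.2 * ((chartOne E G).symm p.1)⁻¹)
    have hc : ContDiffAt ℝ ∞ c (chartOne E G 1, chartOne E G 1) :=
      contDiffAt_chart_comp₂ (f := fun p : G × G => p.1 * p.2 * p.1⁻¹)
        ((contMDiff_fst.mul contMDiff_snd).mul contMDiff_fst.inv) (by simp)
    have h1 : DifferentiableAt ℝ (fderiv ℝ c) (chartOne E G 1, chartOne E G 1) :=
      (hc.fderiv_right (m := ∞) (by norm_cast)).differentiableAt (by simp)
    have h2 : DifferentiableAt ℝ (fun u : E => fderiv ℝ c (u, chartOne E G 1) (0, Y))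
        (chartOne E G 1) := by
      have h3 : DifferentiableAt ℝ (fun u : E => (u, chartOne E G (1 : G))) (chartOne E G 1) := by
        fun_prop
      exact (DifferentiableAt.comp (g := fderiv ℝ c) (f := fun u : E => (u, chartOne E G (1 : G)))
        (chartOne E G 1) h1 h3).clm_apply (by fun_prop)
    refine h2.congr_of_eventuallyEq ?_
    have h : ∀ᶠ p in 𝓝 ((chartOne E G 1, chartOne E G 1) : E × E), DifferentiableAt ℝ c p :=
      ((hc.of_le (m := 1) ENat.LEInfty.out).eventually (by simp)).mono
        fun p hp => hp.differentiableAt (by simp)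
    filter_upwards [(Continuous.prodMk_left (chartOne E G (1 : G))).continuousAt.eventually h]
      with u hu
    have h4 := hasFDerivAt_chart_comp (a := (1 : G)) (by simp)
      (hasModelDerivAt_conj (E := E) ((chartOne E G).symm u)) (mem_extChartAt_source (1 : G))
    have h5 := HasFDerivAt.comp (g := c) (f := fun v : E => (u, v)) (chartOne E G 1)
      hu.hasFDerivAt (hasFDerivAt_prodMk_right u (chartOne E G 1))
    have h6 := DFunLike.congr_fun (h4.unique h5) Y
    rw [modelDeriv_chartOne_one] at h6
    exact h6
  refine ⟨_, hA.hasFDerivAt, fun X => ?_⟩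
  rw [bracket_eq_lieBracket]
  have hmem : (chartOne E G).symm (chartOne E G 1) ∈ (chartOne E G).source := by
    rw [chartOne_symm_apply_one]; exact mem_extChartAt_source _
  refine fderiv_eq_lieBracket_of_partial_deriv (contDiffAt_localMul E G) hA
    (by rw [chartOne_symm_apply_one]; simp) (fun v => ?_) (fun v => ?_) ?_
  · rw [fderiv_localMul_inl hmem ((contDiffAt_localMul E G).differentiableAt (by simp)),
      chartOne_symm_apply_one, modelDeriv_chartOne_one]
    simp
  · rw [fderiv_localMul_inr hmem ((contDiffAt_localMul E G).differentiableAt (by simp)),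
      chartOne_symm_apply_one, modelDeriv_chartOne_one]
    simp
  -- The intertwining hypothesis is dL_a = dR_a ∘ Ad(a), read in the chart.
  · filter_upwards [eventually_symm_mem E G, eventually_differentiableAt_localMul_left E G,
      eventually_differentiableAt_localMul_right E G] with u hu hl hr
    rw [fderiv_localMul_inl hu.2 hr, fderiv_localMul_inr hu.2 hl,
      leftDeriv_eq_rightDeriv_comp_adDeriv]
    rfl

end LieGroup

namespace LieGroup

variable {E : Type*} [NormedAddCommGroup E] [NormedSpace ℝ E]
  {G : Type*} [TopologicalSpace G] [ChartedSpace E G] [Group G] [LieGroup 𝓘(ℝ, E) ∞ G]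

theorem isTopologicalGroup (E G : Type*) [NormedAddCommGroup E] [NormedSpace ℝ E]
    [TopologicalSpace G] [ChartedSpace E G] [Group G] [LieGroup 𝓘(ℝ, E) ∞ G] :
    IsTopologicalGroup G := topologicalGroup_of_lieGroup 𝓘(ℝ, E) ∞

/-- A Lie group modelled on a normed space is Hausdorff. -/
theorem t2Space (E G : Type*) [NormedAddCommGroup E] [NormedSpace ℝ E]
    [TopologicalSpace G] [ChartedSpace E G] [Group G] [LieGroup 𝓘(ℝ, E) ∞ G] : T2Space G := by
  have := isTopologicalGroup E G
  -- For topological groups T0 implies Hausdorff, and inseparable points lie in a common chart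
  -- domain, where the chart is injective.
  have : T0Space G := by
    refine ⟨fun x y h => ?_⟩
    have hx : y ∈ (chartAt E x).source :=
      (h.mem_open_iff (chartAt E x).open_source).1 (mem_chart_source E x)
    refine (chartAt E x).injOn (mem_chart_source E x) hx ?_
    have h1 := (h.map_of_continuousAt ((chartAt E x).continuousAt (mem_chart_source E x))
      ((chartAt E x).continuousAt hx))
    exact h1.eq
  infer_instance

/-! ### Logarithmic derivatives of curves -/

/-- The left logarithmic derivative at `t` of the curve `γ` is `x`. -/
def HasLogDerivAt (γ : ℝ → G) (t : ℝ) (x : E) : Prop :=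
  HasModelDerivAt γ t ((1 : ℝ →L[ℝ] ℝ).smulRight (leftDeriv E (γ t) x))

namespace HasLogDerivAt

omit [LieGroup 𝓘(ℝ, E) ∞ G] in
theorem const (a : G) (t : ℝ) : HasLogDerivAt (fun _ : ℝ => a) t (0 : E) := by
  have h : HasMFDerivAt 𝓘(ℝ, ℝ) 𝓘(ℝ, E) (fun _ : ℝ => a) t (0 : ℝ →L[ℝ] E) := hasMFDerivAt_const a t
  have h2 : ((1 : ℝ →L[ℝ] ℝ).smulRight (leftDeriv E a (0 : E))) = 0 := by ext; simp
  rw [HasLogDerivAt, h2]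
  exact h

omit [LieGroup 𝓘(ℝ, E) ∞ G] in
theorem scomp {γ : ℝ → G} {f : ℝ → ℝ} {t c : ℝ} {x : E} (h : HasLogDerivAt γ (f t) x)
    (hf : HasDerivAt f c t) : HasLogDerivAt (fun s => γ (f s)) t (c • x) := by
  have h1 := HasModelDerivAt.comp h hf.hasFDerivAt.hasModelDerivAt rfl
  rw [HasLogDerivAt]
  convert h1 using 1
  ext
  simp

/-- Product rule: moving the velocity of `α` to the right past `β` conjugates it by the inverse of
`β`. -/
theorem mul {α β : ℝ → G} {t : ℝ} {x y : E} (hα : HasLogDerivAt α t x)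
    (hβ : HasLogDerivAt β t y) :
    HasLogDerivAt (fun s => α s * β s) t (adDeriv E (β t)⁻¹ x + y) := by
  have hm := ((contMDiff_mul 𝓘(ℝ, E) ∞ (G := G)).mdifferentiableAt (by simp)
    (x := (α t, β t))).hasMFDerivAt
  have h := HasMFDerivAt.comp t hm (HasMFDerivAt.prodMk hα hβ)
  have h1 : leftDeriv E (α t * β t) (adDeriv E (β t)⁻¹ x) =
      modelDeriv E E (fun z => z * β t) (α t) (leftDeriv E (α t) x) := by
    have e1 := HasModelDerivAt.comp
      ((contMDiff_mul_right (I := 𝓘(ℝ, E)) (n := ∞) (a := β t)).hasModelDerivAt (α t))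
      (hasModelDerivAt_left (E := E) (α t)) (mul_one _)
    have e2 := HasModelDerivAt.comp (hasModelDerivAt_left (E := E) (α t * β t))
      (hasModelDerivAt_conj (β t)⁻¹) (by simp)
    have e3 : (fun z => α t * β t * ((β t)⁻¹ * z * (β t)⁻¹⁻¹)) = fun z => α t * z * β t := by
      ext z; simp [mul_assoc]
    rw [e3] at e2
    exact DFunLike.congr_fun (e2.unique e1) x
  have h2 : leftDeriv E (α t * β t) y =
      modelDeriv E E (fun z => α t * z) (β t) (leftDeriv E (β t) y) := by
    have e1 := HasModelDerivAt.comp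
      ((contMDiff_mul_left (I := 𝓘(ℝ, E)) (n := ∞) (a := α t)).hasModelDerivAt (β t))
      (hasModelDerivAt_left (E := E) (β t)) (mul_one _)
    have e2 := hasModelDerivAt_left (E := E) (α t * β t)
    have e3 : (fun z => α t * β t * z) = fun z => α t * (β t * z) := by
      ext z; simp [mul_assoc]
    rw [e3] at e2
    exact DFunLike.congr_fun (e2.unique e1) y
  have h3 : HasModelDerivAt (fun s => α s * β s) t
      (modelDeriv ℝ E (fun s => α s * β s) t) :=
    MDifferentiableAt.hasModelDerivAt h.mdifferentiableAt
  have h5 : ∀ v : E, ((1 : ℝ →L[ℝ] ℝ).smulRight v) 1 = v := fun v => by simp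
  have h6 : modelDeriv ℝ E (fun s => α s * β s) t 1 =
      mfderiv (𝓘(ℝ, E).prod 𝓘(ℝ, E)) 𝓘(ℝ, E) (fun p : G × G => p.1 * p.2) (α t, β t)
        ((((1 : ℝ →L[ℝ] ℝ).smulRight (leftDeriv E (α t) x)) 1,
          ((1 : ℝ →L[ℝ] ℝ).smulRight (leftDeriv E (β t) y)) 1) : E × E) :=
    DFunLike.congr_fun h.mfderiv (1 : ℝ)
  have h4 := mfderiv_prod_eq_add_apply (I := 𝓘(ℝ, E)) (I' := 𝓘(ℝ, E)) (I'' := 𝓘(ℝ, E))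
    (f := fun p : G × G => p.1 * p.2) (p := (α t, β t))
    (v := ((leftDeriv E (α t) x, leftDeriv E (β t) y) : E × E))
    ((contMDiff_mul 𝓘(ℝ, E) ∞ (G := G)).mdifferentiableAt (by simp))
  rw [h5, h5] at h6
  rw [HasLogDerivAt]
  convert h3 using 1
  refine ContinuousLinearMap.ext_ring ?_
  rw [h5, map_add, h1, h2, h6]
  exact h4.symm

theorem const_mul {γ : ℝ → G} {t : ℝ} {x : E} (h : HasLogDerivAt γ t x) (a : G) :
    HasLogDerivAt (fun s => a * γ s) t x := by
  simpa using (HasLogDerivAt.const a t).mul h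

end HasLogDerivAt

/-! ### The exponential map from integral curves of left invariant fields -/

section OneParameter

variable [CompleteSpace E]

omit [CompleteSpace E] in
theorem contMDiff_one_mulInvariantVectorField (X : E) :
    ContMDiff 𝓘(ℝ, E) 𝓘(ℝ, E).tangent 1 (fun g : G =>
      (⟨g, mulInvariantVectorField (I := 𝓘(ℝ, E)) (G := G) X g⟩ : TangentBundle 𝓘(ℝ, E) G)) :=
  (contMDiff_mulInvariantVectorField (I := 𝓘(ℝ, E)) (G := G) X).of_le
    (by rw [minSmoothness_of_isRCLikeNormedField]; norm_num)

-- A constant logarithmic derivative `X` means an integral curve of the left invariant field of `X`,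
-- so uniqueness of integral curves on a Hausdorff manifold applies.
omit [CompleteSpace E] in
theorem eq_of_hasLogDerivAt {γ γ' : ℝ → G} {X : E} (h : ∀ t, HasLogDerivAt γ t X)
    (h' : ∀ t, HasLogDerivAt γ' t X) (h0 : γ 0 = γ' 0) : γ = γ' := by
  have := t2Space E G
  have : IsManifold 𝓘(ℝ, E) 1 G := IsManifold.of_le (n := ∞) ENat.LEInfty.out
  exact isMIntegralCurve_Ioo_eq_of_contMDiff_boundaryless (I := 𝓘(ℝ, E)) (t₀ := 0)
    (contMDiff_one_mulInvariantVectorField X) h h' h0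

-- Left translates of one local solution at `1` give solutions through every point on intervals of
-- the same length, so the field is complete.
variable (G) in
theorem exists_hasLogDerivAt (X : E) :
    ∃ γ : ℝ → G, γ 0 = 1 ∧ ∀ t, HasLogDerivAt γ t X := by
  have := t2Space E G
  have : IsManifold 𝓘(ℝ, E) 1 G := IsManifold.of_le (n := ∞) ENat.LEInfty.out
  have hv := contMDiff_one_mulInvariantVectorField (G := G) X
  obtain ⟨γ, h0, hγ⟩ := exists_isMIntegralCurveAt_of_contMDiffAt_boundaryless
    (I := 𝓘(ℝ, E)) (t₀ := 0) (hv.contMDiffAt (x := (1 : G)))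
  obtain ⟨ε, hε, hγ⟩ := isMIntegralCurveAt_iff'.1 hγ
  rw [Real.ball_eq_Ioo, zero_sub, zero_add] at hγ
  refine exists_isMIntegralCurve_of_isMIntegralCurveOn (I := 𝓘(ℝ, E)) hv hε (fun a => ?_) 1
  refine ⟨fun t => a * γ t, by simp [h0], fun t ht => ?_⟩
  have h1 : HasLogDerivAt γ t X := (hγ t ht).hasMFDerivAt (Ioo_mem_nhds ht.1 ht.2)
  exact HasMFDerivAt.hasMFDerivWithinAt (h1.const_mul a)

variable (G) in
/-- The exponential map of the Lie group `G`. -/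
def exp (X : E) : G := (exists_hasLogDerivAt G X).choose 1

/-- `exp` chooses a separate curve for each multiple of `X`; rescaling time and uniqueness show that
one curve carries all the values `exp G (t • X)`. -/
theorem exists_hasLogDerivAt_exp (X : E) :
    ∃ γ : ℝ → G, γ 0 = 1 ∧ (∀ t, HasLogDerivAt γ t X) ∧ ∀ t, γ t = exp G (t • X) := by
  refine ⟨(exists_hasLogDerivAt G X).choose, (exists_hasLogDerivAt G X).choose_spec.1,
    (exists_hasLogDerivAt G X).choose_spec.2, fun t => ?_⟩
  obtain ⟨h0, h1⟩ := (exists_hasLogDerivAt G X).choose_spec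
  obtain ⟨h2, h3⟩ := (exists_hasLogDerivAt G (t • X)).choose_spec
  have h4 := eq_of_hasLogDerivAt h3
    (fun s => HasLogDerivAt.scomp (f := fun s => s * t) (h1 (s * t)) (hasDerivAt_mul_const t))
    (by simp [h0, h2])
  have h5 := congr_fun h4 1
  rw [one_mul] at h5
  exact h5.symm

theorem hasLogDerivAt_exp (X : E) (t : ℝ) : HasLogDerivAt (fun t => exp G (t • X)) t X := by
  obtain ⟨γ, -, h, h'⟩ := exists_hasLogDerivAt_exp (G := G) X
  simp only [← h']
  exact h t

@[simp] theorem exp_zero : exp G (0 : E) = 1 := by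
  obtain ⟨γ, h, -, h'⟩ := exists_hasLogDerivAt_exp (G := G) (0 : E)
  rw [← h, h']
  simp

theorem eq_exp_of_hasLogDerivAt {γ : ℝ → G} {X : E} (h : ∀ t, HasLogDerivAt γ t X)
    (h0 : γ 0 = 1) (t : ℝ) : γ t = exp G (t • X) :=
  congr_fun (eq_of_hasLogDerivAt h (hasLogDerivAt_exp X) (by simp [h0])) t

theorem exp_add_smul (X : E) (s t : ℝ) : exp G ((s + t) • X) = exp G (s • X) * exp G (t • X) := by
  have h1 : ∀ t, HasLogDerivAt (fun t => exp G ((s + t) • X)) t X := fun t => by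
    simpa using HasLogDerivAt.scomp (f := fun t => s + t) (hasLogDerivAt_exp X (s + t))
      ((hasDerivAt_id t).const_add s)
  exact congr_fun (eq_of_hasLogDerivAt h1
    (fun t => (hasLogDerivAt_exp X t).const_mul (exp G (s • X))) (by simp)) t

theorem exp_neg (X : E) : exp G (-X) = (exp G X)⁻¹ := by
  rw [eq_inv_iff_mul_eq_one]
  have := exp_add_smul (G := G) X (-1) 1
  simpa using this.symm

end OneParameter

end LieGroup

/-! ### Regularity of one-parameter subgroups, and Ad along them -/

namespace LieGroup

variable {E : Type*} [NormedAddCommGroup E] [NormedSpace ℝ E] [CompleteSpace E]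
  {G : Type*} [TopologicalSpace G] [ChartedSpace E G] [Group G] [LieGroup 𝓘(ℝ, E) ∞ G]

/-- The curve `t ↦ exp (t X)` in the chart at the identity. -/
theorem eventually_hasDerivAt_chartOne_exp (X : E) : ∀ᶠ t in 𝓝 (0 : ℝ),
    exp G (t • X) ∈ (chartOne E G).source ∧
    HasDerivAt (fun t : ℝ => chartOne E G (exp G (t • X)))
      (fderiv ℝ (localMul E G) (chartOne E G (exp G (t • X)), chartOne E G 1) (0, X)) t := by
  have hc : Continuous fun t : ℝ => exp G (t • X) :=
    continuous_iff_continuousAt.2 fun t => (hasLogDerivAt_exp X t).continuousAt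
  have h0 : exp G ((0 : ℝ) • X) = 1 := by simp
  have hs : ∀ᶠ t in 𝓝 (0 : ℝ), exp G (t • X) ∈ (chartOne E G).source :=
    hc.continuousAt.eventually (by
      simp only [h0]; exact extChartAt_source_mem_nhds (1 : G))
  have hd : ∀ᶠ t in 𝓝 (0 : ℝ), DifferentiableAt ℝ (localMul E G)
      (chartOne E G (exp G (t • X)), chartOne E G 1) := by
    have h1 : ContinuousAt (fun t : ℝ => chartOne E G (exp G (t • X))) 0 :=
      ContinuousAt.comp (by rw [h0]; exact continuousAt_extChartAt (1 : G)) hc.continuousAt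
    have h2 := eventually_differentiableAt_localMul_left E G
    rw [← h0] at h2
    exact h1.eventually (by simpa only [h0] using h2)
  filter_upwards [hs, hd] with t ht htd
  refine ⟨ht, ?_⟩
  have h1 := HasModelDerivAt.comp (hasModelDerivAt_chartOne ht) (hasLogDerivAt_exp X t) rfl
  have h2 : (chartOne E G).symm (chartOne E G (exp G (t • X))) = exp G (t • X) :=
    (chartOne E G).left_inv ht
  rw [fderiv_localMul_inr (by rw [h2]; exact ht) htd, h2]
  simpa using h1.hasFDerivAt.hasDerivAt

theorem hasDerivAt_chartOne_exp (X : E) :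
    HasDerivAt (fun t : ℝ => chartOne E G (exp G (t • X))) X 0 := by
  have h := (eventually_hasDerivAt_chartOne_exp (G := G) X).self_of_nhds.2
  have hmem : (chartOne E G).symm (chartOne E G 1) ∈ (chartOne E G).source := by
    rw [chartOne_symm_apply_one]; exact mem_extChartAt_source _
  rw [zero_smul, exp_zero, fderiv_localMul_inr hmem
    ((contDiffAt_localMul E G).differentiableAt (by simp)), chartOne_symm_apply_one,
    modelDeriv_chartOne_one] at h
  simpa using h

/-- In the chart the curve solves an autonomous equation `c' = F c` with `F` smooth near the base
point, and solutions are as regular as `F`. -/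
theorem contDiffAt_chartOne_exp (X : E) :
    ContDiffAt ℝ ∞ (fun t : ℝ => chartOne E G (exp G (t • X))) 0 := by
  rw [contDiffAt_infty]
  intro n
  set c : ℝ → E := fun t => chartOne E G (exp G (t • X)) with hc
  set F : E → E := fun u => fderiv ℝ (localMul E G) (u, chartOne E G 1) (0, X) with hF
  have hFs : ContDiffAt ℝ n F (chartOne E G 1) := by
    have h1 : ContDiffAt ℝ n (fderiv ℝ (localMul E G)) (chartOne E G 1, chartOne E G 1) :=
      (contDiffAt_localMul E G).fderiv_right (by exact_mod_cast le_top)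
    have h2 : ContDiffAt ℝ n (fun u : E => (u, chartOne E G 1)) (chartOne E G 1) := by fun_prop
    exact (ContDiffAt.comp (g := fderiv ℝ (localMul E G))
      (f := fun u : E => (u, chartOne E G 1)) (chartOne E G 1) h1 h2).clm_apply
      contDiffAt_const
  obtain ⟨U, hU, hFU⟩ := hFs.contDiffOn (m := n) le_rfl (by simp)
  have hd := (eventually_hasDerivAt_chartOne_exp (G := G) X).mono fun t ht => ht.2
  have h0 : c 0 = chartOne E G 1 := by simp [hc]
  have hcU : ∀ᶠ t in 𝓝 (0 : ℝ), c t ∈ U :=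
    hd.self_of_nhds.continuousAt.eventually (by rw [show (fun t : ℝ => chartOne E G
      (exp G (t • X))) 0 = chartOne E G 1 from h0]; exact hU)
  obtain ⟨ε, hε, h⟩ := Metric.eventually_nhds_iff_ball.1 (hd.and hcU)
  have hsub : ∀ t ∈ Set.Icc (-(ε / 2)) (ε / 2), t ∈ Metric.ball (0 : ℝ) ε := fun t ht => by
    rw [mem_ball_zero_iff, Real.norm_eq_abs, abs_lt]
    exact ⟨by linarith [ht.1], by linarith [ht.2]⟩
  have h3 := ODE.contDiffOn_enat_Icc_of_hasDerivWithinAt (n := n) (u := U) (α := c)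
    (f := fun _ => F) (tmin := -(ε / 2)) (tmax := ε / 2)
    (hFU.comp contDiff_snd.contDiffOn fun p hp => hp.2)
    (fun t ht => (h t (hsub t ht)).1.hasDerivWithinAt) (fun t ht => (h t (hsub t ht)).2)
  exact h3.contDiffAt (Icc_mem_nhds (by linarith) (by linarith))

/-- One-parameter subgroups are smooth. -/
theorem contMDiff_exp_smul (X : E) :
    ContMDiff 𝓘(ℝ, ℝ) 𝓘(ℝ, E) ∞ fun t : ℝ => exp G (t • X) := by
  have h0 : ContMDiffAt 𝓘(ℝ, ℝ) 𝓘(ℝ, E) ∞ (fun t : ℝ => exp G (t • X)) 0 := by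
    have h1 := (contDiffAt_chartOne_exp (G := G) X).contMDiffAt
    have h2 : ContMDiffAt 𝓘(ℝ, E) 𝓘(ℝ, E) ∞ (chartOne E G).symm
        (chartOne E G (exp G ((0 : ℝ) • X))) := by
      rw [zero_smul, exp_zero]; exact contMDiffAt_chartOne_symm E G
    refine (h2.comp 0 h1).congr_of_eventuallyEq ?_
    filter_upwards [eventually_hasDerivAt_chartOne_exp (G := G) X] with t ht
    exact ((chartOne E G).left_inv ht.1).symm
  intro s
  -- The homomorphism property carries smoothness at `0` to every `s`.
  have h1 : (fun t : ℝ => exp G (t • X)) =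
      fun t : ℝ => exp G (s • X) * exp G ((t - s) • X) := by
    ext t
    rw [← exp_add_smul, add_sub_cancel]
  rw [h1]
  refine contMDiffAt_const.mul ?_
  have h2 : ContMDiffAt 𝓘(ℝ, ℝ) 𝓘(ℝ, ℝ) ∞ (fun t : ℝ => t - s) s :=
    (contDiff_id.sub contDiff_const).contMDiff.contMDiffAt
  exact ContMDiffAt.comp (g := fun t : ℝ => exp G (t • X)) s (by simpa using h0) h2

/-- At `s = 0` this is the differential of Ad at the identity; elsewhere Ad(exp(sX)) factors out of
Ad(exp(tX)). -/
theorem hasDerivAt_adDeriv_exp (X Y : E) (s : ℝ) :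
    HasDerivAt (fun t : ℝ => adDeriv E (exp G (t • X)) Y)
      (adDeriv E (exp G (s • X)) (bracket (G := G) X Y)) s := by
  have h0 : HasDerivAt (fun t : ℝ => adDeriv E (exp G (t • X)) Y) (bracket (G := G) X Y) 0 := by
    obtain ⟨L, hL, hLX⟩ := hasFDerivAt_adDeriv_symm (G := G) Y
    rw [← hLX]
    have h1 : HasFDerivAt (fun u : E => adDeriv E ((chartOne E G).symm u) Y) L
        (chartOne E G (exp G ((0 : ℝ) • X))) := by simpa using hL
    refine (h1.comp_hasDerivAt 0 (hasDerivAt_chartOne_exp (G := G) X)).congr_of_eventuallyEq ?_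
    filter_upwards [eventually_hasDerivAt_chartOne_exp (G := G) X] with t ht
    simp only [Function.comp_apply]
    rw [(chartOne E G).left_inv ht.1]
  have h1 : (fun t : ℝ => adDeriv E (exp G (t • X)) Y) =
      fun t => adDeriv E (exp G (s • X)) (adDeriv E (exp G ((t - s) • X)) Y) := by
    ext t
    rw [← ContinuousLinearMap.comp_apply, ← adDeriv_mul, ← exp_add_smul, add_sub_cancel]
  rw [h1]
  have h2 : HasDerivAt (fun t : ℝ => adDeriv E (exp G ((t - s) • X)) Y)
      (bracket (G := G) X Y) s := by
    have h3 : HasDerivAt (fun t : ℝ => adDeriv E (exp G (t • X)) Y) (bracket (G := G) X Y)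
      (s - s) := by simpa using h0
    simpa [Function.comp_def] using HasDerivAt.scomp (h := fun t => t - s) s h3 ((hasDerivAt_id s).sub_const s)
  exact (adDeriv E (exp G (s • X))).hasFDerivAt.comp_hasDerivAt s h2

/-! ### The bracket on the model space -/

section Bracket

theorem bracket_add_left (X Y Z : E) :
    bracket (G := G) (X + Y) Z = bracket (G := G) X Z + bracket (G := G) Y Z :=
  add_lie (L := GroupLieAlgebra 𝓘(ℝ, E) G) (M := GroupLieAlgebra 𝓘(ℝ, E) G) X Y Z

theorem bracket_add_right (X Y Z : E) :
    bracket (G := G) X (Y + Z) = bracket (G := G) X Y + bracket (G := G) X Z :=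
  lie_add (L := GroupLieAlgebra 𝓘(ℝ, E) G) (M := GroupLieAlgebra 𝓘(ℝ, E) G) X Y Z

theorem bracket_smul_left (c : ℝ) (X Y : E) :
    bracket (G := G) (c • X) Y = c • bracket (G := G) X Y :=
  smul_lie (R := ℝ) (L := GroupLieAlgebra 𝓘(ℝ, E) G) (M := GroupLieAlgebra 𝓘(ℝ, E) G) c X Y

theorem bracket_smul_right (c : ℝ) (X Y : E) :
    bracket (G := G) X (c • Y) = c • bracket (G := G) X Y :=
  lie_smul (R := ℝ) (L := GroupLieAlgebra 𝓘(ℝ, E) G) (M := GroupLieAlgebra 𝓘(ℝ, E) G) c X Y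

@[simp] theorem bracket_self (X : E) : bracket (G := G) X X = 0 :=
  lie_self (L := GroupLieAlgebra 𝓘(ℝ, E) G) X

theorem bracket_skew (X Y : E) : -bracket (G := G) Y X = bracket (G := G) X Y :=
  lie_skew (L := GroupLieAlgebra 𝓘(ℝ, E) G) X Y

@[simp] theorem bracket_zero_right (X : E) : bracket (G := G) X 0 = 0 :=
  lie_zero (L := GroupLieAlgebra 𝓘(ℝ, E) G) (M := GroupLieAlgebra 𝓘(ℝ, E) G) X

end Bracket

theorem adDeriv_exp_of_bracket_eq_zero {X Y : E} (h : bracket (G := G) X Y = 0) :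
    adDeriv E (exp G X) Y = Y := by
  have h1 : ∀ s : ℝ, HasDerivAt (fun t : ℝ => adDeriv E (exp G (t • X)) Y) 0 s := fun s => by
    simpa [h] using hasDerivAt_adDeriv_exp (G := G) X Y s
  have h2 := is_const_of_deriv_eq_zero (fun s => (h1 s).differentiableAt)
    (fun s => (h1 s).deriv) 1 0
  simpa using h2

/-- The exponential series of ad X stops at the linear term: Ad(exp(tX)) fixes [X, Y], so the
derivative of Ad(exp(tX)) Y is the constant [X, Y]. -/
theorem adDeriv_exp_of_bracket_bracket_eq_zero {X Y : E}
    (h : bracket (G := G) X (bracket (G := G) X Y) = 0) :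
    adDeriv E (exp G X) Y = Y + bracket (G := G) X Y := by
  have h1 : ∀ s : ℝ, HasDerivAt
      (fun t : ℝ => adDeriv E (exp G (t • X)) Y - t • bracket (G := G) X Y) 0 s := fun s => by
    have h2 : adDeriv E (exp G (s • X)) (bracket (G := G) X Y) = bracket (G := G) X Y :=
      adDeriv_exp_of_bracket_eq_zero (by rw [bracket_smul_left, h, smul_zero])
    have h3 := (hasDerivAt_adDeriv_exp (G := G) X Y s).sub
      ((hasDerivAt_id s).smul_const (bracket (G := G) X Y))
    rw [h2, one_smul, sub_self] at h3
    exact h3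
  have h2 := is_const_of_deriv_eq_zero (fun s => (h1 s).differentiableAt)
    (fun s => (h1 s).deriv) 1 0
  simp only [one_smul, zero_smul, exp_zero, adDeriv_one, sub_zero,
    ContinuousLinearMap.id_apply] at h2
  rw [sub_eq_iff_eq_add] at h2
  exact h2

end LieGroup

/-! ### The exponential map of a two-step nilpotent Lie group -/

namespace LieGroup

section TwoStep

variable {E : Type*} [NormedAddCommGroup E] [NormedSpace ℝ E] [CompleteSpace E]
  {G : Type*} [TopologicalSpace G] [ChartedSpace E G] [Group G] [LieGroup 𝓘(ℝ, E) ∞ G]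

theorem bracket_eq_zero_comm {X Y : E} (h : bracket (G := G) X Y = 0) :
    bracket (G := G) Y X = 0 := by
  rw [← bracket_skew, h, neg_zero]

theorem exp_mul_exp_of_bracket_eq_zero {X Y : E} (h : bracket (G := G) X Y = 0) :
    exp G X * exp G Y = exp G (X + Y) := by
  have h1 : ∀ t : ℝ, HasLogDerivAt (fun t : ℝ => exp G (t • X) * exp G (t • Y)) t (X + Y) := by
    intro t
    have h2 := (hasLogDerivAt_exp (G := G) X t).mul (hasLogDerivAt_exp Y t)
    rwa [← exp_neg, ← neg_smul, adDeriv_exp_of_bracket_eq_zero (by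
      rw [bracket_smul_left, bracket_eq_zero_comm h, smul_zero])] at h2
  have h2 := eq_exp_of_hasLogDerivAt h1 (by simp) 1
  simpa using h2

variable (hG : ∀ X Y Z : E, bracket (G := G) X (bracket (G := G) Y Z) = 0)
include hG

/-- The Baker-Campbell-Hausdorff formula in a 2-step nilpotent Lie group. -/
theorem exp_mul_exp (X Y : E) :
    exp G X * exp G Y = exp G (X + Y + (1 / 2 : ℝ) • bracket (G := G) X Y) := by
  set Z := bracket (G := G) X Y with hZ
  -- The curve exp(tX) exp(tY) has logarithmic derivative X + Y + tZ; the central factor with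
  -- coefficient -t²/2 cancels tZ.
  have h1 : ∀ t : ℝ, HasLogDerivAt (fun t : ℝ =>
      exp G (t • X) * exp G (t • Y) * exp G ((-(1 / 2) * t ^ 2) • Z)) t (X + Y) := by
    intro t
    have h2 := (hasLogDerivAt_exp (G := G) X t).mul (hasLogDerivAt_exp Y t)
    rw [← exp_neg, ← neg_smul, adDeriv_exp_of_bracket_bracket_eq_zero (hG _ _ _),
      bracket_smul_left, ← bracket_skew, ← hZ] at h2
    have h3 : HasDerivAt (fun t : ℝ => -(1 / 2) * t ^ 2) (-t) t := by
      refine ((hasDerivAt_pow 2 t).const_mul (-(1 / 2) : ℝ)).congr_deriv ?_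
      norm_num
      ring
    have h4 := h2.mul (HasLogDerivAt.scomp (hasLogDerivAt_exp (G := G) Z _) h3)
    rw [← exp_neg, ← neg_smul, adDeriv_exp_of_bracket_eq_zero (bracket_eq_zero_comm (by
      rw [bracket_smul_right, hG, smul_zero]))] at h4
    convert h4 using 1
    module
  have h2 := eq_exp_of_hasLogDerivAt h1 (by simp) 1
  simp only [one_smul, one_pow, mul_one] at h2
  rw [← exp_mul_exp_of_bracket_eq_zero (X := X + Y) (Y := (1 / 2 : ℝ) • Z)
    (by rw [bracket_smul_right, hG, smul_zero]), ← h2, mul_assoc, neg_smul, exp_neg]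
  simp

omit hG in
theorem bracket_sum_right {ι : Type*} (s : Finset ι) (X : E) (Y : ι → E) :
    bracket (G := G) X (∑ i ∈ s, Y i) = ∑ i ∈ s, bracket (G := G) X (Y i) := by
  classical
  induction s using Finset.induction_on with
  | empty => simp
  | insert a s ha ih => rw [Finset.sum_insert ha, Finset.sum_insert ha, bracket_add_right, ih]

-- Central summands split off one at a time, leaving a product of smooth one-parameter subgroups
-- with smooth parameters.
omit hG in
theorem contMDiff_exp_sum_of_central {V : Type*} [NormedAddCommGroup V] [NormedSpace ℝ V]
    {ι : Type*} (s : Finset ι) {q : ι → V → ℝ} (hq : ∀ i, ContDiff ℝ ∞ (q i)) {Z : ι → E}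
    (hZ : ∀ W i, bracket (G := G) W (Z i) = 0) :
    ContMDiff 𝓘(ℝ, V) 𝓘(ℝ, E) ∞ fun x => exp G (∑ i ∈ s, q i x • Z i) := by
  classical
  induction s using Finset.induction_on with
  | empty => simpa using contMDiff_const
  | insert a s ha ih =>
    have h : (fun x => exp G (∑ i ∈ insert a s, q i x • Z i)) =
        fun x => exp G (q a x • Z a) * exp G (∑ i ∈ s, q i x • Z i) := by
      ext x
      rw [exp_mul_exp_of_bracket_eq_zero, Finset.sum_insert ha]
      simp [bracket_sum_right, bracket_smul_right, hZ]
    rw [h]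
    exact ((contMDiff_exp_smul (G := G) (Z a)).comp (hq a).contMDiff).mul ih

/-- By Baker-Campbell-Hausdorff, peeling off one summand costs a factor whose exponent is a
combination of central brackets with smooth coefficients, covered by the central case. Smoothness of
`exp` thus reduces to that of one-parameter subgroups. -/
theorem contMDiff_exp_sum {V : Type*} [NormedAddCommGroup V] [NormedSpace ℝ V]
    {ι : Type*} (s : Finset ι) {q : ι → V → ℝ} (hq : ∀ i, ContDiff ℝ ∞ (q i)) (e : ι → E) :
    ContMDiff 𝓘(ℝ, V) 𝓘(ℝ, E) ∞ fun x => exp G (∑ i ∈ s, q i x • e i) := by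
  classical
  induction s using Finset.induction_on with
  | empty => simpa using contMDiff_const
  | insert a s ha ih =>
    have h : (fun x => exp G (∑ i ∈ insert a s, q i x • e i)) =
        fun x => exp G (q a x • e a) * exp G (∑ i ∈ s, q i x • e i) *
          exp G (∑ i ∈ s, (-(1 / 2) * (q a x * q i x)) • bracket (G := G) (e a) (e i)) := by
      ext x
      have h1 : ∑ i ∈ s, (-(1 / 2) * (q a x * q i x)) • bracket (G := G) (e a) (e i) =
          -((1 / 2 : ℝ) • bracket (G := G) (q a x • e a) (∑ i ∈ s, q i x • e i)) := by
        rw [bracket_sum_right, ← smul_neg, ← Finset.sum_neg_distrib, Finset.smul_sum]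
        refine Finset.sum_congr rfl fun i _ => ?_
        rw [bracket_smul_left, bracket_smul_right]
        module
      rw [h1, exp_mul_exp hG, exp_mul_exp_of_bracket_eq_zero, Finset.sum_insert ha]
      · congr 1; abel
      · rw [← smul_neg, bracket_smul_right, bracket_skew, hG, smul_zero]
    rw [h]
    refine (((contMDiff_exp_smul (G := G) (e a)).comp (hq a).contMDiff).mul ih).mul ?_
    exact contMDiff_exp_sum_of_central s
      (fun i => contDiff_const.mul ((hq a).mul (hq i))) fun W i => hG _ _ _

/-- The exponential map of a 2-step nilpotent Lie group is smooth. -/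
theorem contMDiff_exp [FiniteDimensional ℝ E] :
    ContMDiff 𝓘(ℝ, E) 𝓘(ℝ, E) ∞ (exp G : E → G) := by
  let b := Module.finBasis ℝ E
  have h := contMDiff_exp_sum hG Finset.univ
    (q := fun i => fun x : E => b.repr x i)
    (fun i => ((b.coord i).toContinuousLinearMap).contDiff) b
  simpa only [b.sum_repr] using h

theorem hasModelDerivAt_exp_zero [FiniteDimensional ℝ E] :
    HasModelDerivAt (exp G : E → G) 0 (ContinuousLinearMap.id ℝ E) := by
  have h := (contMDiff_exp hG).hasModelDerivAt 0
  convert h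
  ext X
  have h1 : HasFDerivAt (fun t : ℝ => t • X) ((1 : ℝ →L[ℝ] ℝ).smulRight X) 0 :=
    ((1 : ℝ →L[ℝ] ℝ).smulRight X).hasFDerivAt
  have h2 := h.comp h1.hasModelDerivAt (zero_smul ℝ X)
  have h3 := hasLogDerivAt_exp (G := G) X 0
  have h4 := DFunLike.congr_fun (HasModelDerivAt.unique h2 h3) 1
  simp at h4
  exact h4.symm

theorem hasStrictFDerivAt_chartOne_exp [FiniteDimensional ℝ E] :
    HasStrictFDerivAt (fun x : E => chartOne E G (exp G x))
      ((ContinuousLinearEquiv.refl ℝ E : E ≃L[ℝ] E) : E →L[ℝ] E) 0 := by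
  have h1 : ContMDiffAt 𝓘(ℝ, E) 𝓘(ℝ, E) ∞ (chartOne E G) (exp G (0 : E)) := by
    rw [exp_zero]; exact contMDiffAt_extChartAt
  have h2 := (h1.comp 0 (contMDiff_exp hG).contMDiffAt).contDiffAt
  refine h2.hasStrictFDerivAt' ?_ (by simp)
  have h3 := (hasModelDerivAt_chartOne (mem_extChartAt_source (1 : G))).comp
    (hasModelDerivAt_exp_zero hG) exp_zero
  rw [modelDeriv_chartOne_one] at h3
  exact h3.hasFDerivAt

/-- Inverse function theorem: in the chart, `exp` has identity derivative at `0`. This is what makes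
`expHom` open. -/
theorem map_exp_nhds_zero [FiniteDimensional ℝ E] : map (exp G) (𝓝 (0 : E)) = 𝓝 1 := by
  have h1 := (hasStrictFDerivAt_chartOne_exp hG).map_nhds_eq_of_equiv
  rw [exp_zero] at h1
  have h2 : map (chartOne E G).symm (𝓝 (chartOne E G 1)) = 𝓝 1 := by
    have := map_extChartAt_symm_nhdsWithin_range (I := 𝓘(ℝ, E)) (1 : G)
    rwa [ModelWithCorners.range_eq_univ, nhdsWithin_univ] at this
  rw [← h2, ← h1, map_map]
  refine map_congr ?_
  have h3 : ∀ᶠ x in 𝓝 (0 : E), exp G x ∈ (chartOne E G).source :=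
    (contMDiff_exp hG).continuous.continuousAt.eventually
      (by rw [exp_zero]; exact extChartAt_source_mem_nhds (1 : G))
  filter_upwards [h3] with x hx
  exact ((chartOne E G).left_inv hx).symm

theorem eventually_eq_zero_of_exp_eq_one [FiniteDimensional ℝ E] :
    ∀ᶠ x in 𝓝 (0 : E), exp G x = 1 → x = 0 := by
  have h1 := hasStrictFDerivAt_chartOne_exp hG
  have h2 := h1.toOpenPartialHomeomorph.open_source.mem_nhds
    h1.mem_toOpenPartialHomeomorph_source
  filter_upwards [h2] with x hx h
  refine h1.toOpenPartialHomeomorph.injOn hx h1.mem_toOpenPartialHomeomorph_source ?_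
  simp only [h1.toOpenPartialHomeomorph_coe, h, exp_zero]

end TwoStep

end LieGroup

/-! ### Even integral structure constants -/

/-- The structure constants of the bilinear operation `m` in the basis `b` are even integers. -/
def HasEvenConstants {V : Type*} [AddCommGroup V] [Module ℝ V] {ι : Type*} [Fintype ι]
    (m : V → V → V) (b : Module.Basis ι ℝ V) : Prop :=
  ∀ i j, ∃ c : ι → ℤ, m (b i) (b j) = ∑ k, (2 * c k : ℝ) • b k

theorem HasEvenConstants.map {V W : Type*} [AddCommGroup V] [Module ℝ V] [AddCommGroup W]
    [Module ℝ W] {ι : Type*} [Fintype ι] {m : V → V → V} {m' : W → W → W}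
    {b : Module.Basis ι ℝ V} (h : HasEvenConstants m b) (e : V ≃ₗ[ℝ] W)
    (he : ∀ x y, e (m x y) = m' (e x) (e y)) : HasEvenConstants m' (b.map e) := by
  intro i j
  obtain ⟨c, hc⟩ := h i j
  refine ⟨c, ?_⟩
  simp only [Module.Basis.map_apply]
  rw [← he, hc, map_sum]
  simp only [map_smul]

/-! ### Two-step nilpotent brackets and their groups -/

/-- A continuous two-step nilpotent Lie bracket on a normed space. -/
structure TwoStepBracket (E : Type*) [NormedAddCommGroup E] [NormedSpace ℝ E] where
  /-- The bracket. -/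
  toCLM : E →L[ℝ] E →L[ℝ] E
  self_eq_zero (x : E) : toCLM x x = 0
  nilpotent (x y z : E) : toCLM x (toCLM y z) = 0

namespace TwoStepBracket

variable {E : Type*} [NormedAddCommGroup E] [NormedSpace ℝ E] (β : TwoStepBracket E)

theorem skew (x y : E) : β.toCLM y x = -β.toCLM x y := by
  have h := β.self_eq_zero (x + y)
  simp only [map_add, _root_.add_apply, β.self_eq_zero, zero_add, add_zero] at h
  exact eq_neg_of_add_eq_zero_left h

theorem nilpotent_left (x y z : E) : β.toCLM (β.toCLM x y) z = 0 := by
  rw [skew, nilpotent, neg_zero]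

/-- The group with the Baker-Campbell-Hausdorff multiplication of a two-step nilpotent bracket. -/
def Grp (_ : TwoStepBracket E) : Type _ := E

variable {β}

instance : TopologicalSpace β.Grp := inferInstanceAs (TopologicalSpace E)

/-- A vector, as an element of the group. -/
def toGrp : E ≃ₜ β.Grp := Homeomorph.refl E

/-- The underlying vector of an element of the group. -/
def Grp.val (x : β.Grp) : E := x

@[ext] theorem Grp.ext {x y : β.Grp} (h : x.val = y.val) : x = y := h

@[simp] theorem val_toGrp (x : E) : (toGrp x : β.Grp).val = x := rfl

theorem continuous_val : Continuous (Grp.val : β.Grp → E) := continuous_id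

instance : Mul β.Grp := ⟨fun x y => toGrp (x.val + y.val + (1 / 2 : ℝ) • β.toCLM x.val y.val)⟩

instance : One β.Grp := ⟨toGrp 0⟩

instance : Inv β.Grp := ⟨fun x => toGrp (-x.val)⟩

@[simp] theorem val_mul (x y : β.Grp) :
    (x * y).val = x.val + y.val + (1 / 2 : ℝ) • β.toCLM x.val y.val := rfl

@[simp] theorem val_one : (1 : β.Grp).val = 0 := rfl

@[simp] theorem val_inv (x : β.Grp) : x⁻¹.val = -x.val := rfl

instance : Group β.Grp where
  mul_assoc x y z := by
    ext
    simp only [val_mul, map_add, map_smul, _root_.add_apply, _root_.smul_apply, nilpotent,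
      nilpotent_left]
    module
  one_mul x := by ext; simp
  mul_one x := by ext; simp
  inv_mul_cancel x := by ext; simp [self_eq_zero]

instance : IsTopologicalGroup β.Grp where
  continuous_mul := by
    have h1 : Continuous fun p : β.Grp × β.Grp => p.1.val := continuous_val.comp continuous_fst
    have h2 : Continuous fun p : β.Grp × β.Grp => p.2.val := continuous_val.comp continuous_snd
    exact toGrp.continuous.comp ((h1.add h2).add
      (((β.toCLM.continuous.comp h1).clm_apply h2).const_smul (1 / 2 : ℝ)))
  continuous_inv := toGrp.continuous.comp continuous_val.neg

/-- A subgroup of a two-step nilpotent group is uniform if it has bounded representatives. -/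
def IsUniform (Λ : Subgroup β.Grp) : Prop :=
  ∃ R : ℝ, ∀ x : β.Grp, ∃ k : β.Grp, ‖k.val‖ ≤ R ∧ ∃ l ∈ Λ, x = k * l

/-! ### Rational structures from lattices -/

/-- With two steps there are no higher terms; hence a subgroup contains the brackets of its
elements. -/
theorem commutator_val (x y : β.Grp) : (x * y * x⁻¹ * y⁻¹).val = β.toCLM x.val y.val := by
  simp only [val_mul, val_inv, map_add, map_smul, map_neg, _root_.add_apply, _root_.smul_apply,
    _root_.neg_apply, nilpotent_left, self_eq_zero, β.skew x.val y.val, map_zero,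
    _root_.zero_apply]
  module

/-- The subgroup of additive combinations of brackets of elements of `Λ`. -/
def bracketSubgroup (Λ : Subgroup β.Grp) : AddSubgroup E :=
  AddSubgroup.closure {z | ∃ x ∈ Λ, ∃ y ∈ Λ, z = β.toCLM x.val y.val}

theorem bracketSubgroup_central {Λ : Subgroup β.Grp} {z : E} (hz : z ∈ bracketSubgroup Λ)
    (x : E) : β.toCLM x z = 0 := by
  induction hz using AddSubgroup.closure_induction with
  | mem z hz => obtain ⟨a, -, b, -, rfl⟩ := hz; exact β.nilpotent _ _ _
  | zero => simp
  | add a b _ _ ha hb => rw [map_add, ha, hb, add_zero]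
  | neg a _ ha => rw [map_neg, ha, neg_zero]

/-- Brackets are commutators and are central, and on central vectors the group product is addition.
-/
theorem toGrp_mem_of_mem_bracketSubgroup {Λ : Subgroup β.Grp} {z : E}
    (hz : z ∈ bracketSubgroup Λ) : toGrp z ∈ Λ := by
  induction hz using AddSubgroup.closure_induction with
  | mem z hz =>
    obtain ⟨a, ha, b, hb, rfl⟩ := hz
    rw [← commutator_val]
    exact Λ.mul_mem (Λ.mul_mem (Λ.mul_mem ha hb) (Λ.inv_mem ha)) (Λ.inv_mem hb)
  | zero => exact Λ.one_mem
  | add a b h _ ha hb =>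
    have h1 : (toGrp (a + b) : β.Grp) = toGrp a * toGrp b := by
      ext
      rw [val_mul, val_toGrp, val_toGrp, val_toGrp, β.skew b a, bracketSubgroup_central h b]
      simp
    rw [h1]
    exact Λ.mul_mem ha hb
  | neg a _ ha => exact Λ.inv_mem ha

/-- An additive subgroup of vectors attached to a subgroup of a two-step nilpotent group: it is
contained in the subgroup, and closed under brackets. -/
def additiveSubgroup (Λ : Subgroup β.Grp) : AddSubgroup E where
  carrier := {v | ∃ x ∈ Λ, ∃ a ∈ bracketSubgroup Λ, v = (2 : ℝ) • x.val + a}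
  zero_mem' := ⟨1, Λ.one_mem, 0, zero_mem _, by simp⟩
  add_mem' := by
    rintro _ _ ⟨x, hx, a, ha, rfl⟩ ⟨y, hy, b, hb, rfl⟩
    -- Doubling the product gives 2x + 2y + [x, y]: the half bracket has become a whole one, which
    -- the bracket subgroup absorbs.
    refine ⟨x * y, Λ.mul_mem hx hy, a + b - β.toCLM x.val y.val,
      sub_mem (add_mem ha hb) (AddSubgroup.subset_closure ⟨x, hx, y, hy, rfl⟩), ?_⟩
    rw [val_mul]
    module
  neg_mem' := by
    rintro _ ⟨x, hx, a, ha, rfl⟩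
    exact ⟨x⁻¹, Λ.inv_mem hx, -a, neg_mem ha, by rw [val_inv]; module⟩

/-- The square `x * x` is the vector 2x, and adding the central `a` is multiplying by it. -/
theorem toGrp_mem_of_mem_additiveSubgroup {Λ : Subgroup β.Grp} {z : E}
    (hz : z ∈ additiveSubgroup Λ) : toGrp z ∈ Λ := by
  obtain ⟨x, hx, a, ha, rfl⟩ := hz
  have h1 : (toGrp ((2 : ℝ) • x.val + a) : β.Grp) = x * x * toGrp a := by
    ext
    simp only [val_mul, val_toGrp, bracketSubgroup_central ha, self_eq_zero]
    module
  rw [h1]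
  exact Λ.mul_mem (Λ.mul_mem hx hx) (toGrp_mem_of_mem_bracketSubgroup ha)

/-- [2x + a, 2y + b] = 4[x, y], and 2[x, y] is twice a commutator of the subgroup. The even
constants come from here. -/
theorem exists_bracket_eq_two_smul {Λ : Subgroup β.Grp} {v w : E}
    (hv : v ∈ additiveSubgroup Λ) (hw : w ∈ additiveSubgroup Λ) :
    ∃ z ∈ additiveSubgroup Λ, β.toCLM v w = (2 : ℝ) • z := by
  obtain ⟨x, hx, a, ha, rfl⟩ := hv
  obtain ⟨y, hy, b, hb, rfl⟩ := hw
  refine ⟨(2 : ℝ) • β.toCLM x.val y.val + 0, ⟨x * y * x⁻¹ * y⁻¹, ?_, 0, zero_mem _, ?_⟩, ?_⟩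
  · exact Λ.mul_mem (Λ.mul_mem (Λ.mul_mem hx hy) (Λ.inv_mem hx)) (Λ.inv_mem hy)
  · rw [commutator_val]
  · simp only [map_add, map_smul, _root_.add_apply, _root_.smul_apply,
      bracketSubgroup_central hb, β.skew _ a, bracketSubgroup_central ha]
    module

variable [FiniteDimensional ℝ E]

/-- A uniform subgroup spans the vector space. -/
theorem span_additiveSubgroup_eq_top {Λ : Subgroup β.Grp} (hΛ : IsUniform Λ) :
    Submodule.span ℝ (additiveSubgroup Λ : Set E) = ⊤ := by
  set V := Submodule.span ℝ (additiveSubgroup Λ : Set E) with hV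
  have hΛV : ∀ l ∈ Λ, l.val ∈ V := fun l hl => by
    have h : (2 : ℝ) • l.val ∈ V :=
      Submodule.subset_span ⟨l, hl, 0, zero_mem _, by rw [add_zero]⟩
    simpa [smul_smul] using V.smul_mem (1 / 2 : ℝ) h
  set D := Submodule.span ℝ {z | ∃ x y, z = β.toCLM x y} with hD
  -- A functional killing `V` and all brackets is invariant under right multiplication by `Λ`, so
  -- uniformity bounds it by its values on a ball; a bounded linear functional vanishes.
  have hVD : V ⊔ D = ⊤ := by
    by_contra hne
    obtain ⟨f, hf, hle⟩ := Submodule.exists_le_ker_of_lt_top _ (lt_top_iff_ne_top.2 hne)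
    obtain ⟨R, hR⟩ := hΛ
    have hfc : Continuous f := f.continuous_of_finiteDimensional
    obtain ⟨C, hC⟩ := ((isCompact_closedBall (0 : E) R).image hfc.norm).bddAbove
    have hbd : ∀ x, ‖f x‖ ≤ C := by
      intro x
      obtain ⟨k, hk, l, hl, hx⟩ := hR (toGrp x)
      have h1 : x = k.val + l.val + (1 / 2 : ℝ) • β.toCLM k.val l.val := by
        rw [← val_mul, ← hx, val_toGrp]
      have h2 : f l.val = 0 := hle ((le_sup_left : V ≤ V ⊔ D) (hΛV l hl))
      have h3 : f (β.toCLM k.val l.val) = 0 :=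
        hle ((le_sup_right : D ≤ V ⊔ D) (Submodule.subset_span ⟨_, _, rfl⟩))
      have h4 : f x = f k.val := by rw [h1]; simp [h2, h3]
      rw [h4]
      exact hC ⟨k.val, by simpa using hk, rfl⟩
    refine hf (LinearMap.ext fun x => ?_)
    by_contra hx
    have hx' : 0 < ‖f x‖ := norm_pos_iff.2 hx
    obtain ⟨n, hn⟩ := exists_nat_gt (C / ‖f x‖)
    have := hbd ((n : ℝ) • x)
    rw [map_smul, norm_smul, Real.norm_natCast] at this
    rw [div_lt_iff₀ hx'] at hn
    linarith
  -- `D` is central and `V ⊔ D` is everything, so each bracket is a bracket of two vectors of `V`,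
  -- and `V` is closed under brackets.
  have hDV : D ≤ V := by
    have hspan : ∀ x y, β.toCLM x y ∈ V := by
      have hVV : ∀ x ∈ V, ∀ y ∈ V, β.toCLM x y ∈ V := by
        intro x hx y hy
        induction hx using Submodule.span_induction with
        | mem x hx =>
          induction hy using Submodule.span_induction with
          | mem y hy =>
            obtain ⟨z, hz, h⟩ := exists_bracket_eq_two_smul hx hy
            rw [h]
            exact V.smul_mem _ (Submodule.subset_span hz)
          | zero => rw [map_zero]; exact V.zero_mem
          | add a b _ _ ha hb => rw [map_add]; exact V.add_mem ha hb
          | smul c a _ ha => rw [map_smul]; exact V.smul_mem _ ha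
        | zero => rw [map_zero]; exact V.zero_mem
        | add a b _ _ ha hb => rw [map_add]; exact V.add_mem ha hb
        | smul c a _ ha => rw [map_smul]; exact V.smul_mem _ ha
      have hD0 : ∀ d ∈ D, ∀ y, β.toCLM y d = 0 := by
        intro d hd y
        induction hd using Submodule.span_induction with
        | mem d hd => obtain ⟨a, b, rfl⟩ := hd; exact β.nilpotent _ _ _
        | zero => simp
        | add a b _ _ ha hb => rw [map_add, ha, hb, add_zero]
        | smul c a _ ha => rw [map_smul, ha, smul_zero]
      intro x y
      obtain ⟨x₁, hx₁, x₂, hx₂, rfl⟩ := Submodule.mem_sup.1 (hVD ▸ Submodule.mem_top (x := x))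
      obtain ⟨y₁, hy₁, y₂, hy₂, rfl⟩ := Submodule.mem_sup.1 (hVD ▸ Submodule.mem_top (x := y))
      simp only [map_add, _root_.add_apply, hD0 _ hy₂, β.skew _ x₂, hD0 _ hx₂, neg_zero, add_zero]
      exact hVV _ hx₁ _ hy₁
    rw [hD, Submodule.span_le]
    rintro _ ⟨x, y, rfl⟩
    exact hspan x y
  rwa [sup_eq_left.2 hDV] at hVD

/-- A lattice in a two-step nilpotent group gives a basis with even integral structure
constants. -/
theorem exists_basis_hasEvenConstants {Λ : Subgroup β.Grp} (hd : DiscreteTopology Λ)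
    (hΛ : IsUniform Λ) :
    ∃ (n : ℕ) (b : Module.Basis (Fin n) ℝ E), HasEvenConstants (fun x y => β.toCLM x y) b := by
  set L : Submodule ℤ E := AddSubgroup.toIntSubmodule (additiveSubgroup Λ) with hL
  have hLd : DiscreteTopology L := by
    have hi : Function.Injective fun x : L =>
        (⟨toGrp x.1, toGrp_mem_of_mem_additiveSubgroup x.2⟩ : Λ) := fun x y h =>
      Subtype.ext (congrArg (fun z : Λ => z.1.val) h)
    exact DiscreteTopology.of_continuous_injective
      ((toGrp.continuous.comp continuous_subtype_val).subtype_mk _) hi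
  have hLs : IsZLattice ℝ L := ⟨span_additiveSubgroup_eq_top hΛ⟩
  have := ZLattice.module_finite ℝ L
  have := ZLattice.module_free ℝ L
  let b₀ := Module.finBasis ℤ L
  refine ⟨_, b₀.ofZLatticeBasis ℝ L, fun i j => ?_⟩
  obtain ⟨z, hz, h⟩ := exists_bracket_eq_two_smul (b₀ i).2 (b₀ j).2
  refine ⟨fun k => b₀.repr ⟨z, hz⟩ k, ?_⟩
  have h1 := congrArg (fun x : L => (x : E)) (b₀.sum_repr ⟨z, hz⟩)
  simp only [Submodule.coe_sum, Submodule.coe_smul_of_tower] at h1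
  simp only [Module.Basis.ofZLatticeBasis_apply]
  refine h.trans ((congrArg (fun v => (2 : ℝ) • v) h1.symm).trans ?_)
  rw [Finset.smul_sum]
  refine Finset.sum_congr rfl fun k _ => ?_
  rw [← Int.cast_smul_eq_zsmul ℝ, smul_smul]

end TwoStepBracket

/-! ### Lattices from a basis with even structure constants -/

namespace TwoStepBracket

section LatticeOfBasis

variable {E : Type*} [NormedAddCommGroup E] [NormedSpace ℝ E] {β : TwoStepBracket E}
  {ι : Type*} [Fintype ι] {b : Module.Basis ι ℝ E}

theorem exists_two_smul_eq_of_hasEvenConstants (hb : HasEvenConstants (fun x y => β.toCLM x y) b)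
    (i j : ι) : ∃ z ∈ Submodule.span ℤ (Set.range b), β.toCLM (b i) (b j) = (2 : ℝ) • z := by
  obtain ⟨c, hc⟩ := hb i j
  refine ⟨∑ k, c k • b k, Submodule.sum_mem _ fun k _ =>
    Submodule.smul_mem _ _ (Submodule.subset_span ⟨k, rfl⟩), hc.trans ?_⟩
  rw [Finset.smul_sum]
  refine Finset.sum_congr rfl fun k _ => ?_
  rw [← Int.cast_smul_eq_zsmul ℝ, smul_smul]

/-- Evenness pays for the half in the group product, so integral vectors are closed under it. -/
theorem half_smul_mem_span (hb : HasEvenConstants (fun x y => β.toCLM x y) b) {x y : E}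
    (hx : x ∈ Submodule.span ℤ (Set.range b)) (hy : y ∈ Submodule.span ℤ (Set.range b)) :
    (1 / 2 : ℝ) • β.toCLM x y ∈ Submodule.span ℤ (Set.range b) := by
  induction hx using Submodule.span_induction with
  | mem x hx =>
    obtain ⟨i, rfl⟩ := hx
    induction hy using Submodule.span_induction with
    | mem y hy =>
      obtain ⟨j, rfl⟩ := hy
      obtain ⟨z, hz, h⟩ := exists_two_smul_eq_of_hasEvenConstants hb i j
      rw [h, smul_smul]
      norm_num
      exact hz
    | zero => simp
    | add a c _ _ ha hc => rw [map_add, smul_add]; exact add_mem ha hc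
    | smul n a _ ha => rw [map_zsmul, smul_comm]; exact Submodule.smul_mem _ _ ha
  | zero => simp
  | add a c _ _ ha hc => rw [map_add, _root_.add_apply, smul_add]; exact add_mem ha hc
  | smul n a _ ha =>
    rw [map_zsmul, _root_.smul_apply, smul_comm]; exact Submodule.smul_mem _ _ ha

/-- The subgroup of integral vectors, for a basis with even integral structure constants. -/
def integralSubgroup (hb : HasEvenConstants (fun x y => β.toCLM x y) b) : Subgroup β.Grp where
  carrier := {x | x.val ∈ Submodule.span ℤ (Set.range b)}
  mul_mem' {_ _} hx hy := add_mem (add_mem hx hy) (half_smul_mem_span hb hx hy)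
  one_mem' := (Submodule.span ℤ (Set.range b)).zero_mem
  inv_mem' {x} hx := (Submodule.span ℤ (Set.range b)).neg_mem (x := x.val) hx

theorem mem_integralSubgroup {hb : HasEvenConstants (fun x y => β.toCLM x y) b} {x : β.Grp} :
    x ∈ integralSubgroup hb ↔ x.val ∈ Submodule.span ℤ (Set.range b) := by
  rfl

theorem discreteTopology_integralSubgroup [FiniteDimensional ℝ E]
    (hb : HasEvenConstants (fun x y => β.toCLM x y) b) :
    DiscreteTopology (integralSubgroup hb) := by
  have hi : Function.Injective fun x : integralSubgroup hb =>
      (⟨x.1.val, mem_integralSubgroup.1 x.2⟩ : Submodule.span ℤ (Set.range b)) := fun x y h =>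
    Subtype.ext (Grp.ext (congrArg (fun z : Submodule.span ℤ (Set.range b) => z.1) h))
  exact DiscreteTopology.of_continuous_injective
    ((continuous_val.comp continuous_subtype_val).subtype_mk _) hi

/-- The fractional and integral parts `r`, `f` of `v` satisfy `r * f = v` up to ½[r, f], a
combination of the central vectors `z i j` = ½[b i, b j] with coefficients r_i f_j. Splitting these
coefficients into integral and fractional parts gives `m` and `c`, and then `v = (r - c) * (f - m)`
with bounded first factor and integral second factor. -/
theorem isUniform_integralSubgroup [FiniteDimensional ℝ E]
    (hb : HasEvenConstants (fun x y => β.toCLM x y) b) : IsUniform (integralSubgroup hb) := by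
  classical
  choose z hz h using exists_two_smul_eq_of_hasEvenConstants hb
  have hc : ∀ i j w, β.toCLM w (z i j) = 0 := fun i j w => by
    have h1 := β.nilpotent w (b i) (b j)
    rw [h, map_smul] at h1
    simpa using h1
  have hc' : ∀ i j w, β.toCLM (z i j) w = 0 := fun i j w => by rw [β.skew, hc, neg_zero]
  refine ⟨∑ i, ‖b i‖ + ∑ i, ∑ j, ‖z i j‖, fun v => ?_⟩
  set r := ZSpan.fract b v.val with hr
  set f : E := (ZSpan.floor b v.val : E) with hf
  have hv : v.val = r + f := by rw [hr, ZSpan.fract_apply]; abel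
  set t : ι → ι → ℝ := fun i j => b.repr r i * b.repr f j with ht
  have hw : (1 / 2 : ℝ) • β.toCLM r f = ∑ i, ∑ j, t i j • z i j := by
    conv_lhs => rw [← b.sum_repr r, ← b.sum_repr f]
    simp only [map_sum, _root_.sum_apply, map_smul, _root_.smul_apply, h, Finset.smul_sum,
      smul_smul]
    rw [Finset.sum_comm]
    refine Finset.sum_congr rfl fun i _ => Finset.sum_congr rfl fun j _ => ?_
    congr 1
    simp only [ht]
    ring
  set c := ∑ i, ∑ j, Int.fract (t i j) • z i j with hcdef
  set m := ∑ i, ∑ j, (⌊t i j⌋ : ℤ) • z i j with hm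
  have hcm : m + c = (1 / 2 : ℝ) • β.toCLM r f := by
    rw [hw, hm, hcdef, ← Finset.sum_add_distrib]
    refine Finset.sum_congr rfl fun i _ => ?_
    rw [← Finset.sum_add_distrib]
    refine Finset.sum_congr rfl fun j _ => ?_
    rw [← Int.cast_smul_eq_zsmul ℝ, ← add_smul, Int.floor_add_fract]
  have hc0 : ∀ w, β.toCLM c w = 0 := fun w => by
    simp [hcdef, map_sum, _root_.sum_apply, hc']
  have hm0 : ∀ w, β.toCLM w m = 0 := fun w => by
    simp [hm, map_sum, hc]
  refine ⟨toGrp (r - c), ?_, toGrp (f - m), ?_, ?_⟩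
  · rw [val_toGrp]
    refine (norm_sub_le _ _).trans (add_le_add (ZSpan.norm_fract_le b _) ?_)
    refine (norm_sum_le _ _).trans (Finset.sum_le_sum fun i _ => ?_)
    refine (norm_sum_le _ _).trans (Finset.sum_le_sum fun j _ => ?_)
    rw [norm_smul, Real.norm_of_nonneg (Int.fract_nonneg _)]
    exact mul_le_of_le_one_left (norm_nonneg _) (Int.fract_lt_one _).le
  · refine mem_integralSubgroup.2 (sub_mem (ZSpan.floor b v.val).2 ?_)
    exact sum_mem fun i _ => sum_mem fun j _ => Submodule.smul_mem _ _ (hz i j)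
  · ext
    rw [val_mul, val_toGrp, val_toGrp, hv, map_sub (β.toCLM _) f m, hm0,
      map_sub β.toCLM, _root_.sub_apply, hc0, sub_zero, sub_zero, ← hcm]
    abel

end LatticeOfBasis

end TwoStepBracket

/-! ### The cotangent Lie algebra -/

namespace CotangentLieAlgebra

variable {L : Type*} [LieRing L] [LieAlgebra ℝ L]

theorem pairing_comm (p q : CotangentLieAlgebra L) : pairing p q = pairing q p := by
  simp only [pairing, add_comm]

theorem pairing_add_left (p p' q : CotangentLieAlgebra L) :
    pairing (p + p') q = pairing p q + pairing p' q := by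
  simp only [pairing, add_fst, add_snd, map_add, LinearMap.add_apply]; ring

theorem pairing_smul_left (c : ℝ) (p q : CotangentLieAlgebra L) :
    pairing (c • p) q = c * pairing p q := by
  simp only [pairing, smul_fst, smul_snd, map_smul, LinearMap.smul_apply, smul_eq_mul]; ring

/-- The canonical pairing is invariant under the adjoint representation. -/
theorem pairing_lie (p q r : CotangentLieAlgebra L) :
    pairing ⁅p, q⁆ r + pairing q ⁅p, r⁆ = 0 := by
  simp only [pairing, bracket_fst, bracket_snd, LinearMap.sub_apply, 
    Module.Dual.lie_apply]
  rw [← lie_skew p.1 q.1, ← lie_skew p.1 r.1, ← lie_skew r.1 q.1]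
  simp only [map_neg]
  ring

theorem eq_zero_of_pairing_eq_zero [FiniteDimensional ℝ L] {p : CotangentLieAlgebra L}
    (h : ∀ q, pairing p q = 0) : p = 0 := by
  have h1 : p.1 = 0 := (Module.forall_dual_apply_eq_zero_iff ℝ _).1 fun f => by
    simpa [pairing] using h (0, f)
  have h2 : p.2 = 0 := LinearMap.ext fun x => by
    simpa [pairing] using h (x, 0)
  exact Prod.ext h1 h2

/-- Each term of the dual component evaluates a functional at a double bracket of `L`. -/
theorem lie_lie_eq_zero (h : ∀ x y z : L, ⁅x, ⁅y, z⁆⁆ = 0) (p q r : CotangentLieAlgebra L) :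
    ⁅p, ⁅q, r⁆⁆ = 0 := by
  have h2 : ⁅p, ⁅q, r⁆⁆.2 = 0 := LinearMap.ext fun x => by
    simp [bracket_snd, bracket_fst, Module.Dual.lie_apply, h]
  exact Prod.ext (h _ _ _) h2

/-- The inclusion of the Lie algebra in its cotangent algebra. -/
def inl : L →ₗ[ℝ] CotangentLieAlgebra L := LinearMap.inl ℝ L (Module.Dual ℝ L)

/-- The inclusion of the dual in the cotangent algebra. -/
def inr : Module.Dual ℝ L →ₗ[ℝ] CotangentLieAlgebra L := LinearMap.inr ℝ L (Module.Dual ℝ L)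

@[simp] theorem inl_fst (x : L) : (inl x).1 = x := rfl

@[simp] theorem inl_snd (x : L) : (inl x).2 = 0 := rfl

@[simp] theorem inr_fst (f : Module.Dual ℝ L) : (inr f).1 = 0 := rfl

@[simp] theorem inr_snd (f : Module.Dual ℝ L) : (inr f).2 = f := rfl

theorem ext {p q : CotangentLieAlgebra L} (h1 : p.1 = q.1) (h2 : p.2 = q.2) : p = q :=
  Prod.ext h1 h2

theorem inl_fst_add_inr_snd (p : CotangentLieAlgebra L) : inl p.1 + inr p.2 = p :=
  ext (add_zero p.1) (zero_add p.2)

open Classical in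
/-- The basis of the cotangent algebra made of a basis and its dual basis. -/
def basis {ι : Type*} [Fintype ι] (b : Module.Basis ι ℝ L) :
    Module.Basis (ι ⊕ ι) ℝ (CotangentLieAlgebra L) :=
  (b.prod b.dualBasis : Module.Basis (ι ⊕ ι) ℝ (L × Module.Dual ℝ L))

section

variable {ι : Type*} [Fintype ι] {b : Module.Basis ι ℝ L}

theorem basis_inl (i : ι) : basis b (Sum.inl i) = inl (b i) :=
  Prod.ext (b.prod_apply_inl_fst _ i) (b.prod_apply_inl_snd _ i)

theorem basis_inr (i : ι) : basis b (Sum.inr i) = inr (b.coord i) := by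
  classical
  refine Prod.ext (b.prod_apply_inr_fst _ i) ((b.prod_apply_inr_snd _ i).trans ?_)
  exact congrFun b.coe_dualBasis i

/-- Coadjoint matrices are negative transposes of adjoint ones, so the new constants are the old
ones up to sign and position, and two dual vectors commute. -/
theorem hasEvenConstants_basis (hb : HasEvenConstants (fun x y => ⁅x, y⁆) b) :
    HasEvenConstants (fun x y => ⁅x, y⁆) (basis b) := by
  choose c hc using hb
  have h0 : ∀ i k, ⁅b i, b.coord k⁆ = ∑ l, (2 * (-c i l k : ℤ) : ℝ) • b.coord l := by
    classical
    refine fun i k => b.ext fun j => ?_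
    have h1 := hc i j
    simp only at h1
    rw [Module.Dual.lie_apply, h1]
    simp [LinearMap.sum_apply, Finsupp.single_apply]
  have key : ∀ (p : CotangentLieAlgebra L) (c d : ι → ℤ), p.1 = ∑ k, (2 * c k : ℝ) • b k →
      p.2 = ∑ k, (2 * d k : ℝ) • b.coord k →
      ∃ e : ι ⊕ ι → ℤ, p = ∑ k, (2 * e k : ℝ) • basis b k := by
    intro p c d h1 h2
    refine ⟨Sum.elim c d, ?_⟩
    rw [← inl_fst_add_inr_snd p, h1, h2, Fintype.sum_sum_type, map_sum, map_sum]
    simp only [Sum.elim_inl, Sum.elim_inr, basis_inl, basis_inr, map_smul]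
  rintro (i | i) (j | j)
  · refine key _ (c i j) 0 ?_ ?_
    · simp only [bracket_fst, basis_inl, inl_fst]; exact hc i j
    · simp only [bracket_snd, basis_inl, inl_snd, lie_zero]; simp
  · refine key _ 0 (fun l => -c i l j) ?_ ?_
    · simp only [bracket_fst, basis_inl, basis_inr, inl_fst, inr_fst, lie_zero]; simp
    · simp only [bracket_snd, basis_inl, basis_inr, inl_fst, inr_fst, inl_snd, inr_snd, lie_zero, sub_zero]; exact h0 i j
  · refine key _ 0 (fun l => c j l i) ?_ ?_
    · simp only [bracket_fst, basis_inl, basis_inr, inl_fst, inr_fst, zero_lie]; simp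
    · simp only [bracket_snd, basis_inl, basis_inr, inl_fst, inr_fst, inl_snd, inr_snd, lie_zero, zero_sub]
      rw [h0, ← Finset.sum_neg_distrib]
      refine Finset.sum_congr rfl fun k _ => ?_
      refine (neg_smul _ _).symm.trans ?_
      simp
  · refine key _ 0 0 ?_ ?_
    · simp only [bracket_fst, basis_inr, inr_fst, lie_zero]; simp
    · simp only [bracket_snd, basis_inr, inr_fst, zero_lie, sub_zero]; simp

end

/-- The canonical pairing has neutral signature. -/
theorem exists_isCompl_pairing [FiniteDimensional ℝ L] :
    ∃ P Q : Submodule ℝ (CotangentLieAlgebra L), IsCompl P Q ∧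
      Module.finrank ℝ P = Module.finrank ℝ Q ∧
      (∀ v ∈ P, v ≠ 0 → 0 < pairing v v) ∧ (∀ v ∈ Q, v ≠ 0 → pairing v v < 0) := by
  let b := Module.finBasis ℝ L
  let σ : L ≃ₗ[ℝ] Module.Dual ℝ L := b.toDualEquiv
  have hσ : ∀ x, x ≠ 0 → 0 < σ x x := by
    intro x hx
    have h1 : σ x x = ∑ i, b.repr x i * b.repr x i := by
      simp only [σ, b.toDualEquiv_apply]
      conv_lhs => rw [← b.sum_repr x]
      simp [LinearMap.sum_apply, Module.Basis.toDual_apply, -Module.Basis.sum_repr]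
    rw [h1]
    refine lt_of_le_of_ne (Finset.sum_nonneg fun i _ => mul_self_nonneg _) fun h => hx ?_
    rw [eq_comm, Finset.sum_eq_zero_iff_of_nonneg fun i _ => mul_self_nonneg _] at h
    exact b.ext_elem fun i => by simpa using h i (Finset.mem_univ i)
  -- `A s` is the graph of `s`, where the quadratic form of the pairing is 2 s(x)(x); the graphs of
  -- `σ` and `-σ` are the definite subspaces.
  let A : (L →ₗ[ℝ] Module.Dual ℝ L) → Submodule ℝ (CotangentLieAlgebra L) := fun s =>
    LinearMap.range (inl + inr ∘ₗ s)
  have hA : ∀ s (v : CotangentLieAlgebra L), v ∈ A s ↔ v.2 = s v.1 := by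
    refine fun s v => ⟨?_, fun h => ⟨v.1, ?_⟩⟩
    · rintro ⟨x, rfl⟩
      simp [add_fst, add_snd]
    · rw [LinearMap.add_apply, LinearMap.comp_apply, ← h, inl_fst_add_inr_snd]
  have hf : ∀ s, Module.finrank ℝ (A s) = Module.finrank ℝ L := fun s =>
    LinearMap.finrank_range_of_inj fun x y h => by
      simpa [add_fst] using congrArg (fun p : CotangentLieAlgebra L => p.1) h
  have h0 : ∀ s (v : CotangentLieAlgebra L), v ∈ A s → v ≠ 0 → v.1 ≠ 0 := fun s v hv h h' =>
    h (Prod.ext h' (by rw [(hA s v).1 hv, h', map_zero]; rfl))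
  refine ⟨A σ, A (-σ), ⟨?_, ?_⟩, (hf _).trans (hf _).symm, fun v hv h => ?_, fun v hv h => ?_⟩
  · rw [Submodule.disjoint_def]
    intro v hv hv'
    by_contra h
    have h1 := h0 _ v hv h
    have h2 := hσ _ h1
    rw [hA] at hv hv'
    have h3 := DFunLike.congr_fun (hv.symm.trans hv') v.1
    simp at h3
    linarith
  · rw [codisjoint_iff, eq_top_iff]
    rintro v -
    set u := (1 / 2 : ℝ) • (v.1 + σ.symm v.2) with hu
    set w := (1 / 2 : ℝ) • (v.1 - σ.symm v.2) with hw
    refine Submodule.mem_sup.2 ⟨inl u + inr (σ u), (hA _ _).2 ?_,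
      inl w + inr (-σ w), (hA _ _).2 ?_, ext ?_ ?_⟩
    · simp [add_fst, add_snd]
    · simp [add_fst, add_snd, -map_neg]
    · simp only [add_fst, inl_fst, inr_fst, hu, hw]; module
    · simp only [add_snd, inl_snd, inr_snd]
      simp only [hu, hw, map_smul, map_add, map_sub,
        LinearEquiv.apply_symm_apply]
      module
  · have h1 := hσ _ (h0 _ v hv h)
    rw [hA] at hv
    rw [pairing, hv]
    simp; linarith
  · have h1 := hσ _ (h0 _ v hv h)
    rw [hA] at hv
    rw [pairing, hv]
    simp; linarith

end CotangentLieAlgebra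

/-! ### Discreteness of a subgroup, tested at the identity -/

theorem Subgroup.discreteTopology_of_eventually {G : Type*} [Group G] [TopologicalSpace G]
    [IsTopologicalGroup G] {S : Subgroup G} (h : ∀ᶠ x in 𝓝 (1 : G), x ∈ S → x = 1) :
    DiscreteTopology S := by
  refine discreteTopology_of_isOpen_singleton_one (isOpen_iff_mem_nhds.2 ?_)
  rintro _ rfl
  have h1 : Tendsto (fun x : S => (x : G)) (𝓝 1) (𝓝 1) := continuous_subtype_val.tendsto _
  filter_upwards [h1.eventually h] with x hx
  exact Subtype.ext (hx x.2)

theorem Subgroup.eventually_eq_one_of_discreteTopology {G : Type*} [Group G] [TopologicalSpace G]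
    {S : Subgroup G} (h : DiscreteTopology S) : ∀ᶠ x in 𝓝 (1 : G), x ∈ S → x = 1 := by
  have h1 : ({1} : Set S) ∈ 𝓝 (1 : S) := (isOpen_discrete _).mem_nhds rfl
  obtain ⟨U, hU, h2⟩ := mem_nhds_subtype _ _ _ |>.1 h1
  filter_upwards [hU] with x hx hxS
  exact congrArg Subtype.val (h2 (a := ⟨x, hxS⟩) hx : (⟨x, hxS⟩ : S) = 1)

/-! ### The exponential homomorphism and the transfer of lattices -/

namespace LieGroup

section ExpHom

variable {E : Type*} [NormedAddCommGroup E] [NormedSpace ℝ E] [CompleteSpace E]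
  [FiniteDimensional ℝ E]
  {G : Type*} [TopologicalSpace G] [ChartedSpace E G] [Group G] [LieGroup 𝓘(ℝ, E) ∞ G]
  (hG : ∀ X Y Z : E, bracket (G := G) X (bracket (G := G) Y Z) = 0)

/-- The bracket of a 2-step nilpotent Lie group. -/
def twoStepBracket : TwoStepBracket E where
  toCLM := (LinearMap.mk₂ ℝ (bracket (G := G)) bracket_add_left bracket_smul_left
    bracket_add_right bracket_smul_right).toContinuousBilinearMap
  self_eq_zero := bracket_self
  nilpotent := hG

/-- The exponential map of a 2-step nilpotent Lie group, as a homomorphism. -/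
def expHom : (twoStepBracket hG).Grp →* G where
  toFun x := exp G x.val
  map_one' := exp_zero
  map_mul' x y := by
    rw [exp_mul_exp hG]
    rfl

theorem expHom_apply (x : (twoStepBracket hG).Grp) : expHom hG x = exp G x.val := rfl

theorem continuous_expHom : Continuous (expHom hG) :=
  (contMDiff_exp hG).continuous.comp TwoStepBracket.continuous_val

theorem isOpenMap_expHom : IsOpenMap (expHom hG) := by
  have := isTopologicalGroup E G
  exact IsTopologicalGroup.isOpenMap_iff_nhds_one.2 (map_exp_nhds_zero hG).ge

theorem eventually_eq_one_of_expHom_eq_one :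
    ∀ᶠ x in 𝓝 (1 : (twoStepBracket hG).Grp), expHom hG x = 1 → x = 1 :=
  eventually_eq_zero_of_exp_eq_one (E := E) hG

theorem isOpen_range_expHom : IsOpen ((expHom hG).range : Set G) := by
  rw [MonoidHom.coe_range]
  exact (isOpenMap_expHom hG).isOpen_range

theorem discreteTopology_comap_expHom {Γ : Subgroup G} (hΓ : DiscreteTopology Γ) :
    DiscreteTopology (Γ.comap (expHom hG)) := by
  have h1 : Tendsto (expHom hG) (𝓝 1) (𝓝 1) := by
    simpa using (continuous_expHom hG).tendsto 1
  refine Subgroup.discreteTopology_of_eventually ?_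
  filter_upwards [h1.eventually (Subgroup.eventually_eq_one_of_discreteTopology hΓ),
    eventually_eq_one_of_expHom_eq_one hG] with x hx hx' h
  exact hx' (hx h)

-- The group need not be connected, so the image `S` of `exp` may be proper. To exp(ball of radius
-- n) Γ the set `U n` adds the complement of SΓ, which is open as a union of cosets Sc. The `U n`
-- increase and their images cover the compact quotient, so a single `n` suffices; classes of points
-- of `S` never come from the added part.
open scoped Pointwise in
theorem isUniform_comap_expHom {Γ : Subgroup G} (hΓ : CompactSpace (G ⧸ Γ)) :
    TwoStepBracket.IsUniform (Γ.comap (expHom hG)) := by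
  have := isTopologicalGroup E G
  set S := (expHom hG).range with hS
  let U : ℕ → Set G := fun n => {a | ∃ x : (twoStepBracket hG).Grp, ‖x.val‖ < n ∧
    ∃ γ ∈ Γ, a = expHom hG x * γ} ∪ {a | ∀ s ∈ S, ∀ γ ∈ Γ, a ≠ s * γ}
  have hU : ∀ n, IsOpen (U n) := by
    intro n
    refine IsOpen.union ?_ ?_
    · have h1 : IsOpen (expHom hG '' {x | ‖x.val‖ < n}) :=
        isOpenMap_expHom hG _ (isOpen_lt (TwoStepBracket.continuous_val.norm) continuous_const)
      convert h1.mul_right (t := (Γ : Set G)) using 1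
      ext a
      simp only [Set.mem_ofPred_eq, Set.mem_mul, Set.mem_image, SetLike.mem_coe]
      constructor
      · rintro ⟨x, hx, γ, hγ, rfl⟩
        exact ⟨_, ⟨x, hx, rfl⟩, γ, hγ, rfl⟩
      · rintro ⟨_, ⟨x, hx, rfl⟩, γ, hγ, rfl⟩
        exact ⟨x, hx, γ, hγ, rfl⟩
    · have h1 : IsOpen ((S : Set G) * {a | ∀ s ∈ S, ∀ γ ∈ Γ, a ≠ s * γ}) :=
        (isOpen_range_expHom hG).mul_right
      convert h1 using 1
      ext a
      simp only [Set.mem_ofPred_eq, Set.mem_mul, SetLike.mem_coe]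
      constructor
      · exact fun h => ⟨1, S.one_mem, a, h, one_mul a⟩
      · rintro ⟨t, ht, c, hc, rfl⟩ s hs γ hγ h
        exact hc (t⁻¹ * s) (S.mul_mem (S.inv_mem ht) hs) γ hγ (by rw [mul_assoc, ← h]; group)
  have hUm : Monotone U := by
    intro m n h
    refine Set.union_subset_union_left _ ?_
    rintro a ⟨x, hx, γ, hγ, rfl⟩
    exact ⟨x, hx.trans_le (by exact_mod_cast h), γ, hγ, rfl⟩
  let V : ℕ → Set (G ⧸ Γ) := fun n => QuotientGroup.mk '' U n
  have hV : ∀ n, IsOpen (V n) := fun n => QuotientGroup.isOpenMap_coe _ (hU n)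
  obtain ⟨n, hn⟩ := isCompact_univ.elim_directed_cover V hV (by
    rintro q -
    induction q using QuotientGroup.induction_on with
    | H a =>
      by_cases ha : ∀ s ∈ S, ∀ γ ∈ Γ, a ≠ s * γ
      · exact Set.mem_iUnion.2 ⟨0, a, Or.inr ha, rfl⟩
      · push Not at ha
        obtain ⟨_, ⟨x, rfl⟩, γ, hγ, h⟩ := ha
        obtain ⟨n, hn⟩ := exists_nat_gt ‖x.val‖
        exact Set.mem_iUnion.2 ⟨n, a, Or.inl ⟨x, hn, γ, hγ, h⟩, rfl⟩)
    (Monotone.directed_le fun m n h => Set.image_mono (hUm h))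
  refine ⟨n, fun x => ?_⟩
  obtain ⟨a, ha, h⟩ := hn (Set.mem_univ (QuotientGroup.mk (expHom hG x) : G ⧸ Γ))
  rw [QuotientGroup.eq] at h
  rcases ha with ⟨k, hk, γ, hγ, rfl⟩ | ha
  · refine ⟨k, hk.le, k⁻¹ * x, ?_, by group⟩
    rw [Subgroup.mem_comap, map_mul, map_inv]
    have := Γ.mul_mem hγ h
    convert this using 1
    group
  · exact absurd (by group) (ha _ ⟨x, rfl⟩ _ (Γ.inv_mem h))

/-- The image is an open subgroup, hence closed, hence everything. -/
theorem surjective_expHom [ConnectedSpace G] : Function.Surjective (expHom hG) := by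
  have := isTopologicalGroup E G
  have h1 : IsClopen ((expHom hG).range : Set G) :=
    ⟨Subgroup.isClosed_of_isOpen _ (isOpen_range_expHom hG), isOpen_range_expHom hG⟩
  have h2 := h1.eq_univ ⟨1, (expHom hG).range.one_mem⟩
  exact fun a => (h2 ▸ Set.mem_univ a : a ∈ ((expHom hG).range : Set G))

instance (β : TwoStepBracket E) : ConnectedSpace β.Grp := inferInstanceAs (ConnectedSpace E)

/-- An open surjective homomorphism with discrete kernel is a covering. Simple connectedness lifts
the identity to a section, which is a left inverse of `expHom` by uniqueness of lifts on the
connected source. -/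
theorem injective_expHom [SimplyConnectedSpace G] : Function.Injective (expHom hG) := by
  have := isTopologicalGroup E G
  have hs := surjective_expHom hG
  have : LocallyPathConnectedSpace G := ChartedSpace.locallyPathConnectedSpace E G
  have hq : IsQuotientMap (expHom hG) :=
    (isOpenMap_expHom hG).isQuotientMap (continuous_expHom hG) hs
  have hd : DiscreteTopology (expHom hG).ker :=
    Subgroup.discreteTopology_of_eventually (eventually_eq_one_of_expHom_eq_one hG)
  have hc := (hq.isQuotientCoveringMap_of_isDiscrete_ker_monoidHom
    (isDiscrete_iff_discreteTopology.2 hd)).isCoveringMap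
  obtain ⟨f, ⟨hf1, hf2⟩, -⟩ := hc.existsUnique_continuousMap_lifts (ContinuousMap.id G) 1 1
    (map_one _)
  have h1 : f ∘ expHom hG = id := by
    refine hc.eq_of_comp_eq (f.continuous.comp (continuous_expHom hG)) continuous_id ?_ 1 ?_
    · rw [← Function.comp_assoc, hf2]; rfl
    · simpa using hf1
  exact (Function.leftInverse_iff_comp.2 h1).injective

theorem isCocompactLattice_map_expHom [SimplyConnectedSpace G]
    {Λ : Subgroup (twoStepBracket hG).Grp} (hd : DiscreteTopology Λ)
    (hu : TwoStepBracket.IsUniform Λ) : IsCocompactLattice (Λ.map (expHom hG)) := by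
  have := isTopologicalGroup E G
  have hi := injective_expHom hG
  refine ⟨Subgroup.discreteTopology_of_eventually ?_, ⟨?_⟩⟩
  · have h1 : map (expHom hG) (𝓝 1) = 𝓝 1 := map_exp_nhds_zero (E := E) hG
    rw [← h1, eventually_map]
    filter_upwards [Subgroup.eventually_eq_one_of_discreteTopology hd] with x hx
    rintro ⟨y, hy, h⟩
    rw [hx (hi h ▸ hy), map_one]
  · obtain ⟨R, hR⟩ := hu
    have h1 : IsCompact ((fun x : E => (QuotientGroup.mk (exp G x) : G ⧸ Λ.map (expHom hG))) ''
        Metric.closedBall 0 R) :=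
      (isCompact_closedBall (0 : E) R).image
        (QuotientGroup.continuous_mk.comp (contMDiff_exp hG).continuous)
    convert h1
    refine (Set.eq_univ_of_forall fun q => ?_).symm
    induction q using QuotientGroup.induction_on with
    | H a =>
      obtain ⟨x, rfl⟩ := surjective_expHom hG a
      obtain ⟨k, hk, l, hl, rfl⟩ := hR x
      refine ⟨k.val, by simpa using hk, QuotientGroup.eq.2 ?_⟩
      rw [map_mul]
      refine ⟨l, hl, ?_⟩
      rw [← expHom_apply]
      group

end ExpHom

end LieGroup

namespace LieGroup

/-! ### Metrics transported by orbit maps -/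

section OrbitMetric

variable {F : Type*} [NormedAddCommGroup F] [NormedSpace ℝ F]
  {G : Type*} [TopologicalSpace G] [ChartedSpace F G] [Group G] [LieGroup 𝓘(ℝ, F) ∞ G]
  {M : Type*} [TopologicalSpace M] [ChartedSpace F M] [MulAction G M]

variable (F G) in
/-- The differential at `1` of the orbit map of `p`, in the model space. -/
def orbitDeriv (p : M) : F →L[ℝ] F := modelDeriv F F (fun a : G => a • p) 1

section

variable [ContMDiffSMul 𝓘(ℝ, F) 𝓘(ℝ, F) ∞ G M]

omit [LieGroup 𝓘(ℝ, F) ∞ G] in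
theorem contMDiff_orbit (p : M) : ContMDiff 𝓘(ℝ, F) 𝓘(ℝ, F) ∞ (fun a : G => a • p) :=
  contMDiff_id.smul contMDiff_const

omit [LieGroup 𝓘(ℝ, F) ∞ G] in
theorem contMDiff_left_smul (a : G) : ContMDiff 𝓘(ℝ, F) 𝓘(ℝ, F) ∞ (fun p : M => a • p) :=
  ContMDiffSMul.contMDiff_const_smul (I := 𝓘(ℝ, F)) a

omit [LieGroup 𝓘(ℝ, F) ∞ G] in
theorem hasModelDerivAt_orbit (p : M) :
    HasModelDerivAt (fun a : G => a • p) 1 (orbitDeriv F G p) :=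
  (contMDiff_orbit p).hasModelDerivAt 1

omit [LieGroup 𝓘(ℝ, F) ∞ G] in
/-- An equivariant map intertwines the orbit derivatives. -/
theorem orbitDeriv_map {M' : Type*} [TopologicalSpace M'] [ChartedSpace F M'] [MulAction G M']
    {f : M → M'} (hf : ∀ (a : G) (p : M), f (a • p) = a • f p) {p : M} {L : F →L[ℝ] F}
    (hL : HasModelDerivAt f p L) : orbitDeriv F G (f p) = L ∘L orbitDeriv F G p := by
  have h := hL.comp (hasModelDerivAt_orbit (G := G) p) (one_smul G p)
  simp only [hf] at h
  exact h.modelDeriv_eq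

/-- Differentiate `(b * a * b⁻¹) • (b • p) = b • (a • p)` in `a`. For an Ad-invariant form this
makes the transported metric invariant under the action. -/
theorem orbitDeriv_smul_comp_adDeriv (b : G) (p : M) :
    orbitDeriv F G (b • p) ∘L adDeriv F b =
      modelDeriv F F (fun q : M => b • q) p ∘L orbitDeriv F G p := by
  have h1 := (hasModelDerivAt_orbit (G := G) (b • p)).comp (hasModelDerivAt_conj (E := F) b)
    (by simp)
  have h2 := ((contMDiff_left_smul (F := F) b).hasModelDerivAt p).comp
    (hasModelDerivAt_orbit (G := G) p) (one_smul G p)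
  refine h1.unique ?_
  convert h2 using 2 with a
  simp [smul_smul]

/-- The orbit derivative at `p`, in the trivialization of the tangent bundle at `p₀`. -/
theorem contMDiffAt_coordChange_comp_orbitDeriv [IsManifold 𝓘(ℝ, F) ∞ M] (p₀ : M) :
    ContMDiffAt 𝓘(ℝ, F) 𝓘(ℝ, F →L[ℝ] F) ∞ (fun p : M =>
      (tangentBundleCore 𝓘(ℝ, F) M).coordChange (achart F p) (achart F p₀) p ∘L
        orbitDeriv F G p) p₀ := by
  have h := ContMDiffAt.mfderiv (I := 𝓘(ℝ, F)) (I' := 𝓘(ℝ, F)) (J := 𝓘(ℝ, F)) (m := ∞) (n := ∞)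
    (x₀ := p₀) (fun (p : M) (a : G) => a • p) (fun _ => 1)
    ((contMDiff_snd.smul contMDiff_fst).contMDiffAt) contMDiffAt_const (by simp)
  refine h.congr_of_eventuallyEq ?_
  filter_upwards [(chartAt F p₀).open_source.mem_nhds (mem_chart_source F p₀)] with p hp
  refine Eq.symm ((inTangentCoordinates_eq (fun _ : M => (1 : G)) (fun p : M => (1 : G) • p)
    (fun p => orbitDeriv F G p) (mem_chart_source F (1 : G)) (by simpa using hp)).trans ?_)
  ext v
  have h1 : (tangentBundleCore 𝓘(ℝ, F) G).coordChange (achart F (1 : G)) (achart F (1 : G)) 1 v =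
      v := (tangentBundleCore 𝓘(ℝ, F) G).coordChange_self (achart F (1 : G)) 1
    (mem_chart_source F (1 : G)) v
  simp only [one_smul, ContinuousLinearMap.comp_apply]
  rw [h1]

end

/-- The bilinear form on the tangent space at `p` which is transported by the orbit map of `p`. -/
def orbitMetricForm (B : F →L[ℝ] F →L[ℝ] ℝ) (p : M) : F →L[ℝ] F →L[ℝ] ℝ :=
  B.bilinearComp (orbitDeriv F G p).inverse (orbitDeriv F G p).inverse

omit [LieGroup 𝓘(ℝ, F) ∞ G] in
theorem orbitMetricForm_apply (B : F →L[ℝ] F →L[ℝ] ℝ) (p : M) (u v : F) :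
    orbitMetricForm (G := G) B p u v =
      B ((orbitDeriv F G p).inverse u) ((orbitDeriv F G p).inverse v) := rfl

omit [LieGroup 𝓘(ℝ, F) ∞ G] in
theorem orbitMetricForm_orbitDeriv (B : F →L[ℝ] F →L[ℝ] ℝ) {p : M}
    (hp : (orbitDeriv F G p).IsInvertible) (u v : F) :
    orbitMetricForm (G := G) B p (orbitDeriv F G p u) (orbitDeriv F G p v) = B u v := by
  rw [orbitMetricForm_apply, hp.inverse_apply_self, hp.inverse_apply_self]

variable [ContMDiffSMul 𝓘(ℝ, F) 𝓘(ℝ, F) ∞ G M] [CompleteSpace F] [IsManifold 𝓘(ℝ, F) ∞ M]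

/-- Inversion of operators is smooth at invertible ones, and the two coordinate changes are mutually
inverse, so smoothness of the orbit derivative in the trivialization passes to its inverse. -/
theorem contMDiffAt_inverse_orbitDeriv_comp (hT : ∀ p : M, (orbitDeriv F G p).IsInvertible)
    (p₀ : M) :
    ContMDiffAt 𝓘(ℝ, F) 𝓘(ℝ, F →L[ℝ] F) ∞ (fun p : M => (orbitDeriv F G p).inverse ∘L
      (tangentBundleCore 𝓘(ℝ, F) M).coordChange (achart F p₀) (achart F p) p) p₀ := by
  have h0 : (tangentBundleCore 𝓘(ℝ, F) M).coordChange (achart F p₀) (achart F p₀) p₀ ∘L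
      orbitDeriv F G p₀ = orbitDeriv F G p₀ := by
    ext v
    exact (tangentBundleCore 𝓘(ℝ, F) M).coordChange_self (achart F p₀) p₀ (mem_chart_source F p₀) _
  obtain ⟨e, he⟩ := hT p₀
  have h1 : ContDiffAt ℝ ∞ ContinuousLinearMap.inverse (orbitDeriv F G p₀) :=
    he ▸ contDiffAt_map_inverse e
  rw [← h0] at h1
  have h2 := h1.contMDiffAt.comp p₀ (contMDiffAt_coordChange_comp_orbitDeriv (G := G) p₀)
  refine h2.congr_of_eventuallyEq ?_
  filter_upwards [(chartAt F p₀).open_source.mem_nhds (mem_chart_source F p₀)] with p hp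
  have h3 : ∀ i j : atlas F M, p ∈ i.1.source → p ∈ j.1.source → ∀ v : F,
      (tangentBundleCore 𝓘(ℝ, F) M).coordChange i j p
        ((tangentBundleCore 𝓘(ℝ, F) M).coordChange j i p v) = v := fun i j hi hj v => by
    rw [(tangentBundleCore 𝓘(ℝ, F) M).coordChange_comp j i j p ⟨⟨hj, hi⟩, hj⟩]
    exact (tangentBundleCore 𝓘(ℝ, F) M).coordChange_self j p hj v
  refine (ContinuousLinearMap.inverse_eq ?_ ?_).symm
  · ext v
    simp only [ContinuousLinearMap.comp_apply, (hT p).self_apply_inverse]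
    exact h3 _ _ (mem_chart_source F p) hp v
  · ext v
    simp only [ContinuousLinearMap.comp_apply]
    refine (congrArg _ (h3 _ _ hp (mem_chart_source F p) _)).trans ?_
    exact (hT p).inverse_apply_self v

/-- In the trivialization at `p₀` the form is `B` pulled back by a smooth family of operators, and
the pullback is quadratic in the operator. -/
theorem contMDiff_orbitMetricForm (hT : ∀ p : M, (orbitDeriv F G p).IsInvertible)
    (B : F →L[ℝ] F →L[ℝ] ℝ) :
    ContMDiff 𝓘(ℝ, F) (𝓘(ℝ, F).prod 𝓘(ℝ, F →L[ℝ] F →L[ℝ] ℝ)) ∞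
      (fun p : M ↦ Bundle.TotalSpace.mk' (F →L[ℝ] F →L[ℝ] ℝ)
        (E := fun p : M ↦ TangentSpace 𝓘(ℝ, F) p →L[ℝ] TangentSpace 𝓘(ℝ, F) p →L[ℝ] ℝ) p
        (orbitMetricForm (F := F) (G := G) B p)) := by
  intro p₀
  refine (contMDiffAt_hom_bundle (F₁ := F) (E₁ := fun p : M => TangentSpace 𝓘(ℝ, F) p)
    (F₂ := F →L[ℝ] ℝ) (E₂ := fun p : M => TangentSpace 𝓘(ℝ, F) p →L[ℝ] ℝ) _).2 ⟨contMDiffAt_id, ?_⟩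
  have h1 := contMDiffAt_inverse_orbitDeriv_comp hT p₀
  have h2 : ContMDiffAt 𝓘(ℝ, F) 𝓘(ℝ, F →L[ℝ] F →L[ℝ] ℝ) ∞ (fun p : M =>
      B.bilinearComp ((orbitDeriv F G p).inverse ∘L
        (tangentBundleCore 𝓘(ℝ, F) M).coordChange (achart F p₀) (achart F p) p)
        ((orbitDeriv F G p).inverse ∘L
        (tangentBundleCore 𝓘(ℝ, F) M).coordChange (achart F p₀) (achart F p) p)) p₀ := by
    have h3 : ContDiff ℝ ∞ fun L : F →L[ℝ] F => B.bilinearComp L L := by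
      have : (fun L : F →L[ℝ] F => B.bilinearComp L L) = fun L : F →L[ℝ] F =>
        ContinuousLinearMap.flipₗᵢ ℝ F F ℝ ((ContinuousLinearMap.flipₗᵢ ℝ F F ℝ (B ∘L L)) ∘L L) := by
        ext; rfl
      rw [this]
      fun_prop
    exact h3.contMDiff.contMDiffAt.comp p₀ h1
  refine h2.congr_of_eventuallyEq ?_
  filter_upwards [(chartAt F p₀).open_source.mem_nhds (mem_chart_source F p₀)] with p hp
  ext u v
  have hb : p ∈ (trivializationAt F (TangentSpace 𝓘(ℝ, F)) p₀).baseSet := by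
    rwa [TangentBundle.trivializationAt_baseSet]
  refine (inCoordinates_apply_eq₂ hb hb (by simp)).trans ?_
  have hs := TangentBundle.symmL_trivializationAt_eq_core (I := 𝓘(ℝ, F)) hp
  have hs' : ∀ w : F, (trivializationAt F (TangentSpace 𝓘(ℝ, F)) p₀).symm p w =
    (tangentBundleCore 𝓘(ℝ, F) M).coordChange (achart F p₀) (achart F p) p w := fun w =>
      (Bundle.Trivialization.symmL_apply (R := ℝ) _ hb w).symm.trans (DFunLike.congr_fun hs w)
  rw [hs', hs']
  simp
  rfl

end OrbitMetric

end LieGroup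

/-! ### The metric transported from an invariant form, and its natural reductivity -/

namespace LieGroup

section OrbitMetric

variable {F : Type*} [NormedAddCommGroup F] [NormedSpace ℝ F] [CompleteSpace F]
  {G : Type*} [TopologicalSpace G] [ChartedSpace F G] [Group G] [LieGroup 𝓘(ℝ, F) ∞ G]
  {M : Type*} [TopologicalSpace M] [ChartedSpace F M] [MulAction G M]
  [ContMDiffSMul 𝓘(ℝ, F) 𝓘(ℝ, F) ∞ G M] [IsManifold 𝓘(ℝ, F) ∞ M]

variable (G) in
/-- A nondegenerate symmetric bilinear form on the Lie algebra which is invariant under the adjoint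
representation of the group. -/
structure IsInvariantForm (B : F →L[ℝ] F →L[ℝ] ℝ) : Prop where
  symm (x y : F) : B x y = B y x
  nondegenerate (x : F) (h : ∀ y, B x y = 0) : x = 0
  adDeriv (a : G) (x y : F) : B (adDeriv F a x) (adDeriv F a y) = B x y

variable {B : F →L[ℝ] F →L[ℝ] ℝ} (hB : IsInvariantForm G B)
  (hT : ∀ p : M, (orbitDeriv F G p).IsInvertible)

/-- The metric which is transported by the orbit maps from an invariant form on the Lie algebra. -/
def orbitMetric : PseudoRiemannianMetric 𝓘(ℝ, F) M where
  val p := orbitMetricForm (F := F) (G := G) B p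
  symm _ _ _ := hB.symm _ _
  nondegenerate p u hu := by
    have h : (orbitDeriv F G p).inverse u = 0 := by
      refine hB.nondegenerate _ fun y => ?_
      have h1 : B ((orbitDeriv F G p).inverse u)
          ((orbitDeriv F G p).inverse (orbitDeriv F G p y)) = 0 := hu (orbitDeriv F G p y)
      rwa [(hT p).inverse_apply_self] at h1
    exact (hT p).inverse.injective (h.trans (map_zero _).symm)
  contMDiff := contMDiff_orbitMetricForm hT B

theorem orbitMetric_val_orbitDeriv (p : M) (u v : F) :
    (orbitMetric hB hT).val p (orbitDeriv F G p u) (orbitDeriv F G p v) = B u v :=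
  orbitMetricForm_orbitDeriv B (hT p) u v

/-- Equivariant maps preserve the metrics transported by the orbit maps. -/
theorem orbitMetric_map {M' : Type*} [TopologicalSpace M'] [ChartedSpace F M'] [MulAction G M']
    [ContMDiffSMul 𝓘(ℝ, F) 𝓘(ℝ, F) ∞ G M'] [IsManifold 𝓘(ℝ, F) ∞ M']
    (hT' : ∀ p : M', (orbitDeriv F G p).IsInvertible)
    {f : M → M'} (hf : ∀ (a : G) (p : M), f (a • p) = a • f p) {p : M} {L : F →L[ℝ] F}
    (hL : HasModelDerivAt f p L) (u v : F) :
    (orbitMetric hB hT').val (f p) (L u) (L v) = (orbitMetric hB hT).val p u v := by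
  obtain ⟨x, rfl⟩ := (hT p).surjective u
  obtain ⟨y, rfl⟩ := (hT p).surjective v
  have h1 := orbitDeriv_map hf hL
  have h2 := orbitMetric_val_orbitDeriv hB hT' (f p) x y
  rw [h1] at h2
  exact h2.trans (orbitMetric_val_orbitDeriv hB hT p x y).symm

theorem isPreservedBy_smul_orbitMetric (a : G) :
    (orbitMetric hB hT).IsPreservedBy fun p : M => a • p := by
  intro p u v
  obtain ⟨x, rfl⟩ := (hT p).surjective u
  obtain ⟨y, rfl⟩ := (hT p).surjective v
  have h1 : ∀ z, modelDeriv F F (fun q : M => a • q) p (orbitDeriv F G p z) =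
      orbitDeriv F G (a • p) (adDeriv F a z) := fun z =>
    (DFunLike.congr_fun (orbitDeriv_smul_comp_adDeriv a p) z).symm
  have h2 : (orbitMetric hB hT).val (a • p)
      (modelDeriv F F (fun q : M => a • q) p (orbitDeriv F G p x))
      (modelDeriv F F (fun q : M => a • q) p (orbitDeriv F G p y)) = B x y := by
    refine (congrArg₂ (fun s t : F => (orbitMetric hB hT).val (a • p) s t) (h1 x) (h1 y)).trans ?_
    exact (orbitMetric_val_orbitDeriv hB hT (a • p) _ _).trans (hB.adDeriv a x y)
  exact h2.trans (orbitMetric_val_orbitDeriv hB hT p x y).symm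

theorem isNeutral_orbitMetric {P Q : Submodule ℝ F} (hPQ : IsCompl P Q)
    (hr : Module.finrank ℝ P = Module.finrank ℝ Q) (hP : ∀ v ∈ P, v ≠ 0 → 0 < B v v)
    (hQ : ∀ v ∈ Q, v ≠ 0 → B v v < 0) : (orbitMetric hB hT).IsNeutral := by
  intro p
  obtain ⟨e, he⟩ := hT p
  have h0 : ∀ v : F, (orbitMetric hB hT).val p (e v) (e v) = B v v := fun v => by
    have h1 := orbitMetric_val_orbitDeriv hB hT p v v
    rwa [← he] at h1
  have key : ∃ P' Q' : Submodule ℝ F, IsCompl P' Q' ∧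
      Module.finrank ℝ P' = Module.finrank ℝ Q' ∧
      (∀ v ∈ P', v ≠ 0 → 0 < (orbitMetric hB hT).val p v v) ∧
      (∀ v ∈ Q', v ≠ 0 → (orbitMetric hB hT).val p v v < 0) := by
    refine ⟨P.map e.toLinearEquiv.toLinearMap, Q.map e.toLinearEquiv.toLinearMap,
      hPQ.map (Submodule.orderIsoMapComap e.toLinearEquiv), ?_, ?_, ?_⟩
    · rw [LinearEquiv.finrank_map_eq, LinearEquiv.finrank_map_eq, hr]
    · rintro _ ⟨v, hv, rfl⟩ h
      exact (hP v hv fun h' => h (by rw [h', map_zero])).trans_eq (h0 v).symm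
    · rintro _ ⟨v, hv, rfl⟩ h
      exact (h0 v).trans_lt (hQ v hv fun h' => h (by rw [h', map_zero]))
  exact key

-- A one-parameter subgroup of the stabilizer has constant orbit, so its velocity is killed by the
-- orbit derivative.
omit [CompleteSpace F] [LieGroup 𝓘(ℝ, F) ∞ G] [IsManifold 𝓘(ℝ, F) ∞ M] in
theorem subgroupLieAlgebra_stabilizer_eq (p : M) (hp : Function.Injective (orbitDeriv F G p)) :
    subgroupLieAlgebra 𝓘(ℝ, F) (MulAction.stabilizer G p) = {0} := by
  refine Set.eq_singleton_iff_unique_mem.2 ⟨⟨fun _ => 1, contMDiff_const, by simp,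
    fun _ => one_mem _, ?_⟩, ?_⟩
  · rw [mfderiv_const]
    rfl
  · rintro x ⟨γ, hγ, hadd, hmem, rfl⟩
    have h0 : γ 0 = 1 := by
      have := hadd 0 0
      simpa using this
    have h1 : HasModelDerivAt γ 0 (modelDeriv ℝ F γ 0) := hγ.hasModelDerivAt 0
    have h2 := (hasModelDerivAt_orbit (G := G) p).comp h1 h0
    have h3 : (fun t => γ t • p) = fun _ => p := funext fun t => hmem t
    have h4 : HasModelDerivAt (fun _ : ℝ => p) 0 (0 : ℝ →L[ℝ] F) := hasMFDerivAt_const p 0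
    have h5 := DFunLike.congr_fun (h2.unique (h3 ▸ h4)) 1
    exact hp (h5.trans (map_zero _).symm)

/-- As the isotropy algebra is zero, 𝔪 is the whole Lie algebra, the projection is the identity, and
the condition is the ad-invariance of `B`. -/
theorem isNaturallyReductive_orbitMetric [MulAction.IsPretransitive G M] [Nonempty M]
    (had : ∀ x y z : F, B (bracket (G := G) x y) z + B y (bracket (G := G) x z) = 0) :
    (orbitMetric hB hT).IsNaturallyReductive 𝓘(ℝ, F) G := by
  let o : M := Classical.arbitrary M
  refine ⟨inferInstance, inferInstance, isPreservedBy_smul_orbitMetric hB hT, o, ⊥, ⊤,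
    isCompl_top_bot, ?_, fun _ _ _ _ => Submodule.mem_top, ?_, ?_⟩
  · rw [subgroupLieAlgebra_stabilizer_eq o (hT o).injective]
    rfl
  · exact Set.bijOn_univ.2 (hT o).bijective
  · intro x _ y _ z _
    have h1 : ∀ u v : F, orbitForm 𝓘(ℝ, F) (G := G) (orbitMetric hB hT) o u v = B u v := by
      intro u v
      have h2 := orbitMetric_val_orbitDeriv hB hT ((1 : G) • o) u v
      have h3 : ∀ w, orbitDeriv F G ((1 : G) • o) w = orbitDeriv F G o w := fun w => by
        rw [one_smul]
      exact (congrArg₂ (fun s t : F => (orbitMetric hB hT).val ((1 : G) • o) s t)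
        (h3 u) (h3 v)).symm.trans h2
    have h2 : ∀ u : GroupLieAlgebra 𝓘(ℝ, F) G,
        Submodule.projection (⊤ : Submodule ℝ (GroupLieAlgebra 𝓘(ℝ, F) G)) ⊥ isCompl_top_bot u = u :=
      fun u => by simp
    rw [h2, h2]
    exact (congrArg₂ (· + ·) (h1 _ _) (h1 _ _)).trans (had x y z)

end OrbitMetric

end LieGroup

/-! ### Smooth structures on the base of a covering -/

namespace IsLocalHomeomorph

variable {F : Type*} [NormedAddCommGroup F] [NormedSpace ℝ F]
  {X : Type*} [TopologicalSpace X] [ChartedSpace F X] [IsManifold 𝓘(ℝ, F) ∞ X]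
  {Y : Type*} [TopologicalSpace Y] {pr : X → Y} (hf : IsLocalHomeomorph pr)

variable (F) in
/-- The smooth maps of the source which commute with `pr` act transitively on the fibers. -/
def HasSmoothDeck (pr : X → Y) : Prop :=
  ∀ x y, pr x = pr y → ∃ d : X → X, ContMDiff 𝓘(ℝ, F) 𝓘(ℝ, F) ∞ d ∧ d x = y ∧ ∀ z, pr (d z) = pr z

variable (hd : HasSmoothDeck F pr) (hs : Function.Surjective pr)

-- Projecting and coming back by a local inverse is, near `x`, the deck map that sends `x` to its
-- new position: both have the same projection and land where `pr` is injective.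
include hd in
omit [IsManifold 𝓘(ℝ, F) ∞ X] in
theorem contMDiffAt_localInverseAt_comp {w x : X} (hx : pr x ∈ (hf.localInverseAt w).source) :
    ContMDiffAt 𝓘(ℝ, F) 𝓘(ℝ, F) ∞ (fun z => hf.localInverseAt w (pr z)) x := by
  obtain ⟨d, hdc, hdx, hdpr⟩ := hd x (hf.localInverseAt w (pr x))
    (hf.apply_localInverseAt_of_mem hx).symm
  refine hdc.contMDiffAt.congr_of_eventuallyEq ?_
  have h1 : ∀ᶠ z in 𝓝 x, pr z ∈ (hf.localInverseAt w).source :=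
    hf.continuous.continuousAt.eventually ((hf.localInverseAt w).open_source.mem_nhds hx)
  have h2 : ∀ᶠ z in 𝓝 x, d z ∈ (hf.localInverseAt w).target := by
    refine hdc.continuous.continuousAt.eventually ((hf.localInverseAt w).open_target.mem_nhds ?_)
    rw [hdx]
    exact (hf.localInverseAt w).map_source hx
  filter_upwards [h1, h2] with z hz1 hz2
  refine hf.injOn_localInverseAt_target ((hf.localInverseAt w).map_source hz1) hz2 ?_
  rw [hf.apply_localInverseAt_of_mem hz1, hdpr]

-- Transition maps are local deck maps read in charts of the source.
include hd in
theorem isManifold_chartedSpace :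
    letI : ChartedSpace F Y := hf.chartedSpace hs
    IsManifold 𝓘(ℝ, F) ∞ Y := by
  let _ : ChartedSpace F Y := hf.chartedSpace hs
  refine isManifold_of_contDiffOn _ _ _ ?_
  rintro _ _ ⟨p, rfl⟩ ⟨q, rfl⟩
  set g := hs.hasRightInverse.choose with hg
  set v := g p
  set w := g q
  have hu' : ∀ u ∈ ((((hf.localInverseAt v).trans (chartAt F v)).symm.trans
      ((hf.localInverseAt w).trans (chartAt F w))).source), ContDiffAt ℝ ∞
      (fun u => chartAt F w (hf.localInverseAt w (pr ((chartAt F v).symm u)))) u := by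
    intro u hu
    simp only [OpenPartialHomeomorph.trans_source, OpenPartialHomeomorph.symm_source,
      Set.mem_inter_iff, Set.mem_preimage,
      OpenPartialHomeomorph.trans_symm_eq_symm_trans_symm, OpenPartialHomeomorph.coe_trans,
      Function.comp_apply, hf.localInverseAt_symm] at hu
    have h1 := (contMDiffOn_chart_symm (I := 𝓘(ℝ, F)) (n := ∞) (x := v)).contMDiffAt
      ((chartAt F v).open_target.mem_nhds hu.1.1)
    have h2 := (contMDiffOn_chart (I := 𝓘(ℝ, F)) (n := ∞) (x := w)).contMDiffAt
      ((chartAt F w).open_source.mem_nhds hu.2.2)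
    have h3 := ContMDiffAt.comp (f := fun z => hf.localInverseAt w (pr z))
      ((chartAt F v).symm u) h2 (contMDiffAt_localInverseAt_comp hf hd hu.2.1)
    exact contMDiffAt_iff_contDiffAt.1 (h3.comp u h1)
  intro u hu
  simp only [modelWithCornersSelf_coe, modelWithCornersSelf_coe_symm, Set.preimage_id,
    Set.range_id, Set.inter_univ] at hu
  refine ((hu' u hu).congr_of_eventuallyEq (Eventually.of_forall fun z => ?_)).contDiffWithinAt
  simp only [mfld_simps]
  rw [hf.localInverseAt_symm]

omit [NormedSpace ℝ F] in
theorem chartAt_eq (q : Y) :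
    letI : ChartedSpace F Y := hf.chartedSpace hs
    ∃ w, pr w = q ∧ chartAt F q = (hf.localInverseAt w).trans (chartAt F w) :=
  ⟨_, hs.hasRightInverse.choose_spec q, rfl⟩

include hd in
theorem contMDiff_chartedSpace :
    letI : ChartedSpace F Y := hf.chartedSpace hs
    ContMDiff 𝓘(ℝ, F) 𝓘(ℝ, F) ∞ pr := by
  let _ : ChartedSpace F Y := hf.chartedSpace hs
  intro x
  refine contMDiffAt_iff_target.2 ⟨hf.continuous.continuousAt, ?_⟩
  obtain ⟨w, hw, hc⟩ := chartAt_eq (F := F) hf hs (pr x)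
  have h1 : pr x ∈ (hf.localInverseAt w).source := hw ▸ hf.apply_self_mem_localInverseAt_source
  have h2 : hf.localInverseAt w (pr x) ∈ (chartAt F w).source := by
    rw [← hw, hf.localInverseAt_apply_self]
    exact mem_chart_source F w
  have h3 := (contMDiffOn_chart (I := 𝓘(ℝ, F)) (n := ∞) (x := w)).contMDiffAt
    ((chartAt F w).open_source.mem_nhds h2)
  refine (h3.comp x (contMDiffAt_localInverseAt_comp hf hd h1)).congr_of_eventuallyEq
    (Eventually.of_forall fun z => ?_)
  simp only [extChartAt, mfld_simps]
  rw [hc]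
  rfl

-- Near `pr x`, `f` is `f ∘ pr` after a local section. The chart at `pr x` is built at some `w` of
-- the fiber, so a deck map first moves the smoothness from `x` to `w`.
include hd in
theorem contMDiffAt_of_comp {Z E' : Type*} [NormedAddCommGroup E'] [NormedSpace ℝ E']
    [TopologicalSpace Z] [ChartedSpace E' Z] {f : Y → Z} {x : X}
    (h : ContMDiffAt 𝓘(ℝ, F) 𝓘(ℝ, E') ∞ (fun z => f (pr z)) x) :
    letI : ChartedSpace F Y := hf.chartedSpace hs
    ContMDiffAt 𝓘(ℝ, F) 𝓘(ℝ, E') ∞ f (pr x) := by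
  let _ : ChartedSpace F Y := hf.chartedSpace hs
  have := isManifold_chartedSpace hf hd hs
  obtain ⟨w, hw, hc⟩ := chartAt_eq (F := F) hf hs (pr x)
  obtain ⟨d, hdc, hdw, hdpr⟩ := hd w x hw
  have h1 : ContMDiffAt 𝓘(ℝ, F) 𝓘(ℝ, E') ∞ (fun z => f (pr z)) w := by
    rw [← hdw] at h
    simpa [Function.comp_def, hdpr] using h.comp w hdc.contMDiffAt
  have h2 : pr x ∈ (hf.localInverseAt w).source := hw ▸ hf.apply_self_mem_localInverseAt_source
  have h2' : hf.localInverseAt w (pr x) = w := by rw [← hw, hf.localInverseAt_apply_self]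
  have h3 := (contMDiffOn_chart (I := 𝓘(ℝ, F)) (n := ∞) (x := pr x)).contMDiffAt
    ((chartAt F (pr x)).open_source.mem_nhds (mem_chart_source F (pr x)))
  have h4 : chartAt F (pr x) (pr x) = chartAt F w w := by
    rw [hc, OpenPartialHomeomorph.coe_trans, Function.comp_apply, h2']
  have h5 := (contMDiffOn_chart_symm (I := 𝓘(ℝ, F)) (n := ∞) (x := w)).contMDiffAt
    ((chartAt F w).open_target.mem_nhds (mem_chart_target F w))
  rw [← h4] at h5
  have h6 := h5.comp (pr x) h3
  have h7 : ((chartAt F w).symm ∘ chartAt F (pr x)) (pr x) = w := by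
    rw [Function.comp_apply, h4, (chartAt F w).left_inv (mem_chart_source F w)]
  rw [← h7] at h1
  refine (h1.comp (pr x) h6).congr_of_eventuallyEq ?_
  filter_upwards [(chartAt F (pr x)).open_source.mem_nhds (mem_chart_source F (pr x))] with y hy
  rw [hc] at hy ⊢
  simp only [OpenPartialHomeomorph.trans_source, Set.mem_inter_iff, Set.mem_preimage] at hy
  simp only [OpenPartialHomeomorph.coe_trans, Function.comp_apply]
  rw [(chartAt F w).left_inv hy.2, hf.apply_localInverseAt_of_mem hy.1]

include hd in
theorem contMDiffAt_localInverseAt {w : X} {y : Y} (hy : y ∈ (hf.localInverseAt w).source) :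
    letI : ChartedSpace F Y := hf.chartedSpace hs
    ContMDiffAt 𝓘(ℝ, F) 𝓘(ℝ, F) ∞ (hf.localInverseAt w) y := by
  obtain ⟨x, rfl⟩ := hs y
  exact contMDiffAt_of_comp hf hd hs (contMDiffAt_localInverseAt_comp hf hd hy)

include hd in
theorem isLocalDiffeomorph_chartedSpace :
    letI : ChartedSpace F Y := hf.chartedSpace hs
    IsLocalDiffeomorph 𝓘(ℝ, F) 𝓘(ℝ, F) ∞ pr := by
  let _ : ChartedSpace F Y := hf.chartedSpace hs
  intro x
  refine ⟨{ toPartialEquiv := (hf.localInverseAt x).symm.toPartialEquiv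
            open_source := (hf.localInverseAt x).open_target
            open_target := (hf.localInverseAt x).open_source
            contMDiffOn_toFun := ?_
            contMDiffOn_invFun := ?_ }, ?_, ?_⟩
  · have h : ((hf.localInverseAt x).symm : X → Y) = pr := hf.localInverseAt_symm x
    exact (contMDiff_chartedSpace hf hd hs).contMDiffOn.congr fun y _ => congrFun h y
  · exact fun y hy => (contMDiffAt_localInverseAt hf hd hs hy).contMDiffWithinAt
  · exact hf.self_mem_localInverseAt_target
  · have h : ((hf.localInverseAt x).symm : X → Y) = pr := hf.localInverseAt_symm x
    exact fun y _ => (congrFun h y).symm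

end IsLocalHomeomorph

namespace LieGroup

/-! ### Quotients by discrete subgroups -/

section Quotient

variable {F : Type*} [NormedAddCommGroup F] [NormedSpace ℝ F]
  {G : Type*} [TopologicalSpace G] [ChartedSpace F G] [Group G] [LieGroup 𝓘(ℝ, F) ∞ G]
  {Γ : Subgroup G}

variable (F) in
include F in
theorem isLocalHomeomorph_mk (hΓ : DiscreteTopology Γ) :
    IsLocalHomeomorph (QuotientGroup.mk : G → G ⧸ Γ) := by
  have := isTopologicalGroup F G
  exact (Γ.isQuotientCoveringMap (isDiscrete_iff_discreteTopology.2 hΓ)).isCoveringMap.isLocalHomeomorph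

/-- The deck maps are the right translations by elements of `Γ`. -/
theorem hasSmoothDeck_mk :
    IsLocalHomeomorph.HasSmoothDeck F (QuotientGroup.mk : G → G ⧸ Γ) := by
  intro x y h
  refine ⟨fun z => z * (x⁻¹ * y), contMDiff_mul_right, by group, fun z => ?_⟩
  rw [QuotientGroup.mk_mul_of_mem _ (QuotientGroup.eq.1 h)]

variable (F) in
/-- The smooth structure of the quotient of a Lie group by a discrete subgroup. -/
@[reducible] def quotientChartedSpace (hΓ : DiscreteTopology Γ) : ChartedSpace F (G ⧸ Γ) :=
  (isLocalHomeomorph_mk F hΓ).chartedSpace QuotientGroup.mk_surjective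

variable (hΓ : DiscreteTopology Γ)

theorem isManifold_quotient :
    letI := quotientChartedSpace F hΓ
    IsManifold 𝓘(ℝ, F) ∞ (G ⧸ Γ) :=
  IsLocalHomeomorph.isManifold_chartedSpace _ hasSmoothDeck_mk _

theorem isLocalDiffeomorph_mk :
    letI := quotientChartedSpace F hΓ
    IsLocalDiffeomorph 𝓘(ℝ, F) 𝓘(ℝ, F) ∞ (fun a : G => (a : G ⧸ Γ)) :=
  IsLocalHomeomorph.isLocalDiffeomorph_chartedSpace _ hasSmoothDeck_mk _

/-- Locally the action multiplies in `G` after a smooth local section of the projection, then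
projects. -/
theorem contMDiffSMul_quotient :
    letI := quotientChartedSpace F hΓ
    ContMDiffSMul 𝓘(ℝ, F) 𝓘(ℝ, F) ∞ G (G ⧸ Γ) := by
  let _ := quotientChartedSpace F hΓ
  have hl := isLocalHomeomorph_mk F hΓ
  refine ⟨fun ⟨a, q⟩ => ?_⟩
  obtain ⟨x, rfl⟩ := QuotientGroup.mk_surjective q
  have h1 : ContMDiff 𝓘(ℝ, F) 𝓘(ℝ, F) ∞ (QuotientGroup.mk : G → G ⧸ Γ) :=
    IsLocalHomeomorph.contMDiff_chartedSpace hl hasSmoothDeck_mk QuotientGroup.mk_surjective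
  have h2 : ContMDiffAt 𝓘(ℝ, F) 𝓘(ℝ, F) ∞ (hl.localInverseAt x) (x : G ⧸ Γ) :=
    IsLocalHomeomorph.contMDiffAt_localInverseAt hl hasSmoothDeck_mk QuotientGroup.mk_surjective
      hl.apply_self_mem_localInverseAt_source
  have h3 : ContMDiffAt (𝓘(ℝ, F).prod 𝓘(ℝ, F)) 𝓘(ℝ, F) ∞
      (fun p : G × (G ⧸ Γ) => ((p.1 * hl.localInverseAt x p.2 : G) : G ⧸ Γ)) (a, (x : G ⧸ Γ)) :=
    h1.contMDiffAt.comp _ (contMDiffAt_fst.mul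
      (ContMDiffAt.comp (g := hl.localInverseAt x) (f := Prod.snd) _ h2 contMDiffAt_snd))
  refine h3.congr_of_eventuallyEq ?_
  have h4 : ∀ᶠ p : G × (G ⧸ Γ) in 𝓝 (a, (x : G ⧸ Γ)), p.2 ∈ (hl.localInverseAt x).source :=
    continuous_snd.continuousAt.eventually ((hl.localInverseAt x).open_source.mem_nhds
      hl.apply_self_mem_localInverseAt_source)
  filter_upwards [h4] with p hp
  conv_lhs => rw [← hl.apply_localInverseAt_of_mem hp]
  rfl

/-- The orbit map of `p` is the right translation by `p`. -/
theorem orbitDeriv_isInvertible_self (p : G) : (orbitDeriv F G p).IsInvertible := by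
  have h1 : HasModelDerivAt (fun a : G => a * p) 1 (orbitDeriv F G p) := hasModelDerivAt_right p
  have h2 := (contMDiff_mul_right (I := 𝓘(ℝ, F)) (n := ∞) (a := p⁻¹)).hasModelDerivAt p
  refine ContinuousLinearMap.IsInvertible.of_inverse
    (g := modelDeriv F F (fun a : G => a * p⁻¹) p) ?_ ?_
  · have h3 := h1.comp h2 (mul_inv_cancel p)
    simp only [inv_mul_cancel_right] at h3
    exact h3.unique (HasModelDerivAt.id p)
  · have h3 := h2.comp h1 (one_mul p)
    simp only [mul_inv_cancel_right] at h3
    exact h3.unique (HasModelDerivAt.id 1)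

theorem orbitDeriv_isInvertible_quotient (q : G ⧸ Γ) :
    letI := quotientChartedSpace F hΓ
    (orbitDeriv F G q).IsInvertible := by
  let _ := quotientChartedSpace F hΓ
  obtain ⟨a, rfl⟩ := QuotientGroup.mk_surjective q
  have h1 := isLocalDiffeomorph_mk (F := F) hΓ a
  have h2 := (h1.mdifferentiableAt (by simp)).hasModelDerivAt
  have h3 : (modelDeriv F F (fun a : G => (a : G ⧸ Γ)) a).IsInvertible :=
    ⟨h1.mfderivToContinuousLinearEquiv (by simp), rfl⟩
  have h4 := orbitDeriv_map (G := G) (f := fun a : G => (a : G ⧸ Γ))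
    (fun _ _ => rfl) h2
  rw [h4]
  exact h3.comp (orbitDeriv_isInvertible_self a)

end Quotient

/-! ### Two-step nilpotent Lie groups -/

section TwoStep

variable {E : Type*} [NormedAddCommGroup E] [NormedSpace ℝ E]
  {G : Type*} [TopologicalSpace G] [ChartedSpace E G] [Group G] [LieGroup 𝓘(ℝ, E) ∞ G]

theorem lie_lie_eq_zero_of_lowerCentralSeries {L : Type*} [LieRing L] [LieAlgebra ℝ L]
    (h : LieModule.lowerCentralSeries ℝ L L 2 = ⊥) (x y z : L) : ⁅x, ⁅y, z⁆⁆ = 0 := by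
  have h2 : ⁅x, ⁅y, z⁆⁆ ∈ LieModule.lowerCentralSeries ℝ L L 2 := by
    rw [LieModule.lowerCentralSeries_succ, LieModule.lowerCentralSeries_succ]
    exact LieSubmodule.lie_mem_lie (LieSubmodule.mem_top x)
      (LieSubmodule.lie_mem_lie (LieSubmodule.mem_top y) (LieSubmodule.mem_top z))
  rw [h] at h2
  exact (LieSubmodule.mem_bot _).1 h2

variable [CompleteSpace E] [FiniteDimensional ℝ E]

/-- A 2-step nilpotent Lie group with a cocompact lattice has a rational Lie algebra. -/
theorem exists_basis_hasEvenConstants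
    (hG : ∀ X Y Z : E, bracket (G := G) X (bracket (G := G) Y Z) = 0)
    {Γ : Subgroup G} (hΓ : IsCocompactLattice Γ) :
    ∃ (n : ℕ) (b : Module.Basis (Fin n) ℝ E), HasEvenConstants (bracket (G := G)) b :=
  TwoStepBracket.exists_basis_hasEvenConstants (discreteTopology_comap_expHom hG hΓ.discrete)
    (isUniform_comap_expHom hG hΓ.cocompact)

/-- A simply connected 2-step nilpotent Lie group with a rational Lie algebra has a cocompact
lattice. -/
theorem exists_isCocompactLattice [SimplyConnectedSpace G]
    (hG : ∀ X Y Z : E, bracket (G := G) X (bracket (G := G) Y Z) = 0)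
    {ι : Type*} [Fintype ι] {b : Module.Basis ι ℝ E}
    (hb : HasEvenConstants (bracket (G := G)) b) : ∃ Γ : Subgroup G, IsCocompactLattice Γ :=
  ⟨_, isCocompactLattice_map_expHom hG
    (TwoStepBracket.discreteTopology_integralSubgroup (β := twoStepBracket hG) hb)
    (TwoStepBracket.isUniform_integralSubgroup (β := twoStepBracket hG) hb)⟩

/-- An ad-invariant form on the Lie algebra of a connected 2-step nilpotent Lie group is invariant
under the adjoint representation. -/
theorem isInvariantForm_of_bracket [ConnectedSpace G]
    (hG : ∀ X Y Z : E, bracket (G := G) X (bracket (G := G) Y Z) = 0)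
    {B : E →L[ℝ] E →L[ℝ] ℝ} (hs : ∀ x y, B x y = B y x)
    (hn : ∀ x, (∀ y, B x y = 0) → x = 0)
    (had : ∀ x y z, B (bracket (G := G) x y) z + B y (bracket (G := G) x z) = 0) :
    IsInvariantForm G B := by
  refine ⟨hs, hn, fun a x y => ?_⟩
  obtain ⟨v, rfl⟩ := surjective_expHom hG a
  rw [expHom_apply, adDeriv_exp_of_bracket_bracket_eq_zero (hG _ _ _),
    adDeriv_exp_of_bracket_bracket_eq_zero (hG _ _ _)]
  have h1 := had v.val x y
  -- The quadratic term B([v, x], [v, y]) = -B(x, [v, [v, y]]) vanishes in two steps.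
  have h2 := had v.val x (bracket (G := G) v.val y)
  rw [hG, map_zero, add_zero] at h2
  simp only [map_add, _root_.add_apply]
  rw [h2]
  linarith

end TwoStep

end LieGroup

end

/-! ### The bi-invariant neutral metric and its compact quotient -/

theorem mainTheorem6
    {E : Type*} [NormedAddCommGroup E] [NormedSpace ℝ E] [FiniteDimensional ℝ E]
    [CompleteSpace E]
    {N : Type*} [TopologicalSpace N] [ChartedSpace E N] [Group N] [LieGroup 𝓘(ℝ, E) ∞ N]
    (hN : LieModule.lowerCentralSeries ℝ (GroupLieAlgebra 𝓘(ℝ, E) N)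
      (GroupLieAlgebra 𝓘(ℝ, E) N) 2 = ⊥)
    (hlat : ∃ Γ₀ : Subgroup N, IsCocompactLattice Γ₀)
    {F : Type*} [NormedAddCommGroup F] [NormedSpace ℝ F] [FiniteDimensional ℝ F]
    [CompleteSpace F]
    {G : Type*} [TopologicalSpace G] [ChartedSpace F G] [Group G] [LieGroup 𝓘(ℝ, F) ∞ G]
    [SimplyConnectedSpace G]
    (φ : GroupLieAlgebra 𝓘(ℝ, F) G ≃ₗ⁅ℝ⁆
      CotangentLieAlgebra (GroupLieAlgebra 𝓘(ℝ, E) N)) :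
    ∃ g : PseudoRiemannianMetric 𝓘(ℝ, F) G, g.IsBiInvariant ∧ g.IsNeutral ∧
      (∀ x y : GroupLieAlgebra 𝓘(ℝ, F) G,
        g.val 1 x y = CotangentLieAlgebra.pairing (φ x) (φ y)) ∧
      ∃ Γ : Subgroup G, IsCocompactLattice Γ ∧ T2Space (G ⧸ Γ) ∧
        ∃ (_ : ChartedSpace F (G ⧸ Γ)) (_ : IsManifold 𝓘(ℝ, F) ∞ (G ⧸ Γ)),
          IsLocalDiffeomorph 𝓘(ℝ, F) 𝓘(ℝ, F) ∞ (fun a : G => (a : G ⧸ Γ)) ∧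
          ∃ gΓ : PseudoRiemannianMetric 𝓘(ℝ, F) (G ⧸ Γ),
            (∀ (a : G) (u v : TangentSpace 𝓘(ℝ, F) a),
              gΓ.val (a : G ⧸ Γ)
                (mfderiv 𝓘(ℝ, F) 𝓘(ℝ, F) (fun b : G => (b : G ⧸ Γ)) a u)
                (mfderiv 𝓘(ℝ, F) 𝓘(ℝ, F) (fun b : G => (b : G ⧸ Γ)) a v) = g.val a u v) ∧
            gΓ.IsNeutral ∧ gΓ.IsNaturallyReductive 𝓘(ℝ, F) G := by
  open LieGroup CotangentLieAlgebra in
  have hNL := lie_lie_eq_zero_of_lowerCentralSeries hN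
  have hfin : FiniteDimensional ℝ (GroupLieAlgebra 𝓘(ℝ, E) N) :=
    inferInstanceAs (FiniteDimensional ℝ E)
  let e : F ≃ₗ[ℝ] CotangentLieAlgebra (GroupLieAlgebra 𝓘(ℝ, E) N) := φ.toLinearEquiv
  have he : ∀ x y : F, e (bracket (G := G) x y) = ⁅e x, e y⁆ := fun x y => φ.map_lie x y
  have he' : ∀ p q, e.symm ⁅p, q⁆ = bracket (G := G) (e.symm p) (e.symm q) := fun p q => by
    rw [LinearEquiv.symm_apply_eq, he, e.apply_symm_apply, e.apply_symm_apply]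
  have hG : ∀ X Y Z : F, bracket (G := G) X (bracket (G := G) Y Z) = 0 := fun X Y Z => by
    rw [← e.map_eq_zero_iff, he, he, lie_lie_eq_zero hNL]
  have hconst : ∃ (n : ℕ) (b : Module.Basis (Fin n) ℝ (GroupLieAlgebra 𝓘(ℝ, E) N)),
      HasEvenConstants (fun x y => ⁅x, y⁆) b := by
    obtain ⟨Γ₀, hΓ₀⟩ := hlat
    exact LieGroup.exists_basis_hasEvenConstants (E := E) (G := N) (fun x y z => hNL x y z) hΓ₀
  obtain ⟨n, b, hb⟩ := hconst
  obtain ⟨Γ, hΓ⟩ := exists_isCocompactLattice hG ((hasEvenConstants_basis hb).map e.symm he')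
  let B : F →L[ℝ] F →L[ℝ] ℝ := (LinearMap.mk₂ ℝ (fun x y : F => pairing (e x) (e y))
    (fun x x' y => by rw [map_add, pairing_add_left])
    (fun c x y => by rw [map_smul, pairing_smul_left, smul_eq_mul])
    (fun x y y' => by rw [map_add, pairing_comm, pairing_add_left, pairing_comm,
      pairing_comm (e y')])
    (fun c x y => by rw [map_smul, pairing_comm, pairing_smul_left, pairing_comm,
      smul_eq_mul])).toContinuousBilinearMap
  have hBe : ∀ x y, B x y = pairing (e x) (e y) := fun _ _ => rfl
  have had : ∀ x y z, B (bracket (G := G) x y) z + B y (bracket (G := G) x z) = 0 :=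
    fun x y z => by rw [hBe, hBe, he, he, pairing_lie]
  have hB : IsInvariantForm G B := isInvariantForm_of_bracket hG (fun x y => pairing_comm _ _)
    (fun x h => e.map_eq_zero_iff.1 (eq_zero_of_pairing_eq_zero fun q => by
      have := h (e.symm q)
      rwa [hBe, e.apply_symm_apply] at this)) had
  obtain ⟨P, Q, hPQ, hr, hP, hQ⟩ := exists_isCompl_pairing (L := GroupLieAlgebra 𝓘(ℝ, E) N)
  have hPQ' : IsCompl (P.map e.symm.toLinearMap) (Q.map e.symm.toLinearMap) :=
    hPQ.map (Submodule.orderIsoMapComap e.symm)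
  have hr' : Module.finrank ℝ (P.map e.symm.toLinearMap) =
      Module.finrank ℝ (Q.map e.symm.toLinearMap) := by
    rw [LinearEquiv.finrank_map_eq, LinearEquiv.finrank_map_eq, hr]
  have hP' : ∀ v ∈ P.map e.symm.toLinearMap, v ≠ 0 → 0 < B v v := by
    rintro _ ⟨v, hv, rfl⟩ h
    rw [hBe, LinearEquiv.coe_coe, e.apply_symm_apply]
    exact hP v hv fun h' => h (by rw [h', map_zero])
  have hQ' : ∀ v ∈ Q.map e.symm.toLinearMap, v ≠ 0 → B v v < 0 := by
    rintro _ ⟨v, hv, rfl⟩ h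
    rw [hBe, LinearEquiv.coe_coe, e.apply_symm_apply]
    exact hQ v hv fun h' => h (by rw [h', map_zero])
  have hT : ∀ p : G, (orbitDeriv F G p).IsInvertible := orbitDeriv_isInvertible_self
  -- Hence the transported metric at `1` is the pairing itself.
  have hone : ∀ x : F, orbitDeriv F G (1 : G) x = x := by
    have h1 : HasModelDerivAt (fun a : G => a * 1) 1 (orbitDeriv F G (1 : G)) :=
      hasModelDerivAt_right 1
    simp only [mul_one] at h1
    exact DFunLike.congr_fun (h1.unique (HasModelDerivAt.id 1))
  have htop := isTopologicalGroup F G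
  have ht2 := t2Space F G
  have hd := hΓ.discrete
  refine ⟨orbitMetric hB hT, fun a => ⟨isPreservedBy_smul_orbitMetric hB hT a, fun p u v => ?_⟩,
    isNeutral_orbitMetric hB hT hPQ' hr' hP' hQ', fun x y => ?_, Γ, hΓ, ?_,
    quotientChartedSpace F hd, isManifold_quotient hd, isLocalDiffeomorph_mk hd, ?_⟩
  -- Right translations commute with the left action, so they are equivariant; only left invariance
  -- calls on the Ad-invariance of `B`.
  · exact orbitMetric_map hB hT hT (f := fun x => x * a) (fun b p => mul_assoc b p a)
      ((contMDiff_mul_right (I := 𝓘(ℝ, F)) (n := ∞) (a := a)).hasModelDerivAt p) u v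
  · have h1 := orbitMetric_val_orbitDeriv hB hT 1 x y
    exact (congrArg₂ (fun s t : F => (orbitMetric hB hT).val 1 s t) (hone x) (hone y)).symm.trans h1
  -- A discrete subgroup of a Hausdorff group is closed, so the quotient is Hausdorff.
  · infer_instance
  · let _ := quotientChartedSpace F hd
    have := isManifold_quotient (F := F) hd
    have := contMDiffSMul_quotient (F := F) hd
    have hT' : ∀ q : G ⧸ Γ, (orbitDeriv F G q).IsInvertible := orbitDeriv_isInvertible_quotient hd
    refine ⟨orbitMetric hB hT', fun a u v => ?_, isNeutral_orbitMetric hB hT' hPQ' hr' hP' hQ',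
      isNaturallyReductive_orbitMetric hB hT' had⟩
    -- The projection is equivariant, so it matches the two transported metrics.
    exact orbitMetric_map hB hT hT' (f := fun x : G => (x : G ⧸ Γ)) (fun b p => rfl)
      ((isLocalDiffeomorph_mk (F := F) hd a).mdifferentiableAt (by simp)).hasModelDerivAt u v
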